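/- Let $d\ge 1$. Let $\mathbb T_d$ be the infinite $d$-ary tree (the root $\rho$ has $d$ neighbours, every other vertex has $d+1$), and let $\mathbb T_d^n$ be the subtree induced by the vertices within distance $n$ of $\rho$; its leaves are the vertices at distance exactly $n$. Let $\mu^0_{n,d}$ be the uniform probability measure on the (finite) set of functions $f:\mathbb T_d^n\to\mathbb Z$ with $|f(u)-f(v)|\le 1$ for all neighbours $u,v$ and $f=0$ on the leaves. Say that $\mu^0_{n,d}$ converges in the local weak sense if there is a probability measure $\nu$ on $\mathbb Z^{\mathbb T_d}$ such that, for every $r\ge 0$, the restriction to $\mathbb T_d^r$ of $f_n\sim\mu^0_{n,d}$ converges in distribution, as $n\to\infty$, to the restriction to $\mathbb T_d^r$ of $f\sim\nu$. 1. $\mu^0_{n,d}$ converges in the local weak sense as $n\to\infty$ if and only if $2\le d\le 7$. 2. For $z:\mathbb Z\to[0,\infty)$ put $A(z)_i=(z_{i-1}+z_i+z_{i+1})^d$ and $F(z)=A(z)/\sum_j A(z)_j$. Let $\mathcal E$ be the set of probability distributions $z$ on $\mathbb Z$ with $z_{-i}=z_i$ whose support is an interval of $\mathbb Z$ or all of $\mathbb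 Z$. For $z\in\mathcal E$ put $\mathsf R(z)_i=z_i/z_{i-1}$ for $i\ge1$ (and $0$ if $z_{i-1}=0$). The map $\mathsf R$ is injective on $\mathcal E$; let $\mathcal R=\mathsf R(\mathcal E)$, let $\psi=\mathsf R\circ F\circ\mathsf R^{-1}:\mathcal R\to\mathcal R$, and let $\mathbf 0=(0,0,\dots)=\mathsf R(\delta_0)\in\mathcal R$. For real numbers $a,b,c$ let $\mathcal S_{a,b,c}$ be the set of $x\in\mathcal R$ with $a\le x_1\le b$ and $0\le x_n\le c$ for all $n\ge2$. Suppose $d\ge 8$, and put $\mathcal U=\mathcal S_{0.4,\,1,\,0.01}$ and $\mathcal D=\mathcal S_{0,\,0.78^d,\,0.01}$. Then $x_1-y_1\ge 0.26$ for all $x\in\mathcal U$, $y\in\mathcal D$; $\psi(\mathcal U)\subset\mathcal D$ and $\psi(\mathcal D)\subset\mathcal U$; and $\psi^{(2k)}(\mathbf 0)\in\mathcal D$ and $\psi^{(2k+1)}(\mathbf 0)\in\mathcal U$ for all $k\ge0$. In particular $\psi^{(k)}(\mathbf 0)$ does not converge pointwise as $k\to\infty$. -/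

import Mathlib

open Filter Topology MeasureTheory

noncomputable section

namespace TreeLipschitz

/-! ### Lipschitz functions on the `d`-ary tree -/

/-- `f : V → ℤ` is `M`-Lipschitz on the graph `G`. -/
def IsLipschitzOn {V : Type*} (G : SimpleGraph V) (M : ℕ) (f : V → ℤ) : Prop :=
  ∀ u v : V, G.Adj u v → |f u - f v| ≤ (M : ℤ)

/-- The infinite `d`-ary tree. A vertex is a word over `Fin d`, the root is the empty word, and
the children of `u` are the `d` words `a :: u`. The distance from the root is the length. -/
def daryTree (d : ℕ) : SimpleGraph (List (Fin d)) :=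
  SimpleGraph.fromRel fun u v => ∃ a : Fin d, v = a :: u

/-- The vertices of the `d`-ary tree within distance `n` from the root. -/
def ball (d n : ℕ) : Set (List (Fin d)) := {v | v.length ≤ n}

/-- The 1-Lipschitz integer functions on the `d`-ary tree of height `n` that vanish on the leaves
(the vertices at distance `n` from the root). -/
def zeroBoundary (d n : ℕ) : Set (ball d n → ℤ) :=
  {f | IsLipschitzOn ((daryTree d).induce (ball d n)) 1 f ∧
    ∀ v : ball d n, v.1.length = n → f v = 0}

/-- The uniform law on `zeroBoundary d n` (for `1 ≤ d` this set is finite and nonempty). -/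
def mu0 (d n : ℕ) : Measure (ball d n → ℤ) :=
  ProbabilityTheory.uniformOn (zeroBoundary d n)

/-- The event, for a function `f` on the tree of height `n`, that `f` restricted to the ball of
radius `r` is `ξ` (only used for `n → ∞` with `r` fixed, so for `r ≤ n`). -/
def restrictEq {d r : ℕ} (n : ℕ) (ξ : ball d r → ℤ) : Set (ball d n → ℤ) :=
  {f | ∀ (v : List (Fin d)) (hn : v ∈ ball d n) (hr : v ∈ ball d r), f ⟨v, hn⟩ = ξ ⟨v, hr⟩}

/-- Local weak convergence of laws `μ n` of random functions on the trees of height `n` to the law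
`ν` of a random function on the infinite tree: for every radius `r`, the restriction to the ball of
radius `r` converges in distribution. (That restriction takes values in a countable discrete set
and `ν` is required below to be a probability measure, so that convergence in distribution is
convergence of the probability of every value.) -/
def LocalWeakTendsto {d : ℕ} (μ : ∀ n : ℕ, Measure (ball d n → ℤ))
    (ν : Measure (List (Fin d) → ℤ)) : Prop :=
  ∀ (r : ℕ) (ξ : ball d r → ℤ),
    Tendsto (fun n => μ n (restrictEq n ξ)) atTop (𝓝 (ν {f | ∀ v : ball d r, f v = ξ v}))

/-- The sequence of laws has a local weak limit, which is a probability measure. -/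
def LocalWeakConverges {d : ℕ} (μ : ∀ n : ℕ, Measure (ball d n → ℤ)) : Prop :=
  ∃ ν : Measure (List (Fin d) → ℤ), IsProbabilityMeasure ν ∧ LocalWeakTendsto μ ν

/-! ### Ratio coordinates -/

/-- The unnormalized recursion `A(z)_i = (z_{i-1} + z_i + z_{i+1})^d`. -/
def opA (d : ℕ) (z : ℤ → ℝ) : ℤ → ℝ := fun i => (z (i - 1) + z i + z (i + 1)) ^ d

/-- The recursion `F(z) = A(z) / ∑ A(z)_i` for the law of the height at the root. -/
def opF (d : ℕ) (z : ℤ → ℝ) : ℤ → ℝ := fun i => opA d z i / ∑' j : ℤ, opA d z j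

/-- Symmetric probability distributions on `ℤ` whose support is an interval or all of `ℤ`. -/
def symDist : Set (ℤ → ℝ) :=
  {z | (∀ i, 0 ≤ z i) ∧ HasSum z 1 ∧ (∀ i, z (-i) = z i) ∧ (Function.support z).OrdConnected}

/-- The ratio map: coordinate `k` of `ratio z` is the `(k+1)`-st ratio `z_{k+1} / z_k`, with value
`0` if `z_k = 0`. -/
def ratio (z : ℤ → ℝ) : ℕ → ℝ := fun k => z (k + 1) / z k

/-- The image of `symDist` under the ratio map, which is injective on `symDist`. -/
def ratioSet : Set (ℕ → ℝ) := ratio '' symDist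

/-- The recursion in ratio coordinates, `ratio ∘ F ∘ ratio⁻¹` on `ratioSet`. -/
def psi (d : ℕ) (x : ℕ → ℝ) : ℕ → ℝ := ratio (opF d (Function.invFunOn ratio symDist x))

/-- Ratio sequences whose first coordinate is in `[a, b]` and whose other coordinates are in
`[0, c]`. -/
def envelope (a b c : ℝ) : Set (ℕ → ℝ) :=
  {x | x ∈ ratioSet ∧ a ≤ x 0 ∧ x 0 ≤ b ∧ ∀ k, 1 ≤ k → 0 ≤ x k ∧ x k ≤ c}

/-- The upper basin: first ratio in `[0.4, 1]`, the others in `[0, 0.01]`. -/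
def upperBasin : Set (ℕ → ℝ) := envelope 0.4 1 0.01

/-- The lower basin: first ratio in `[0, 0.78^d]`, the others in `[0, 0.01]`. -/
def lowerBasin (d : ℕ) : Set (ℕ → ℝ) := envelope 0 (0.78 ^ d) 0.01

end TreeLipschitz

end

/-! Given the height at the root, the `d` subtrees below it are independent, so under `mu0 d n` the
root height has law F^n(δ_0) (`mu0_agreeUpTo_zero`). Uncovering one more level multiplies
probabilities by transitions built from F^m(δ_0), where m is the height of the subtrees left
uncovered (`mu0_agreeUpTo_succ`). Everything thus reduces to the orbit of δ_0 under F. Local weak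
convergence forces this orbit to converge pointwise to a probability law (`exists_root_limit`);
conversely, pointwise convergence to a strictly positive law suffices, the limit being a
tree-indexed Markov chain (`localWeakConverges_of_tendsto`).

In ratio coordinates F becomes the explicit map `ratioStep`. Its first coordinate decreases in x_0
(as long as x_1 ≤ 1) and increases in x_1; the others increase in every variable. Hence the image of
a box is controlled by corner values (`ratioStep_mem_ratioBox`). When the later ratios are
negligible, what remains is t ↦ ((1+t)/(1+2t))^d, whose slope at its fixed point is about -0.96 for
d = 7 and -1.05 for d = 8: this is the source of the threshold.

For d ≥ 8 two disjoint boxes are exchanged, so the first ratio oscillates. For 2 ≤ d ≤ 7, interval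
arithmetic traps the orbit in a small box on which `ratioStep` contracts a weighted sup norm; the
ratios converge, and dominated convergence recovers the laws (`exists_tendsto_iterate_opF`). For d =
1, F averages over three neighbours, and a limit law would be affine on the naturals and summable,
hence zero. -/

noncomputable section

namespace TreeLipschitz

/-! ### The recursion in ratio coordinates -/

/-- The explicit form of the recursion in ratio coordinates. -/
def ratioStep (d : ℕ) (x : ℕ → ℝ) : ℕ → ℝ
  | 0 => ((1 + x 0 + x 0 * x 1) / (1 + 2 * x 0)) ^ d
  | k + 1 => (x k * (1 + x (k + 1) + x (k + 1) * x (k + 2)) / (1 + x k + x k * x (k + 1))) ^ d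

section symDist

variable {z : ℤ → ℝ}

/-- By symmetry the support contains some i together with -i, and an interval containing both
contains 0. -/
lemma symDist_zero_pos (hz : z ∈ symDist) : 0 < z 0 := by
  obtain ⟨h0, h1, hs, hc⟩ := hz
  have hne : ∃ i, z i ≠ 0 := by
    by_contra! h
    have : z = 0 := funext h
    rw [this] at h1
    exact one_ne_zero (h1.unique hasSum_zero)
  obtain ⟨i, hi⟩ := hne
  have hi' : z (-i) ≠ 0 := by rwa [hs]
  have key : (0 : ℤ) ∈ Function.support z := by
    rcases le_total 0 i with h | h
    · exact hc.out hi' hi ⟨by omega, h⟩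
    · exact hc.out hi hi' ⟨h, by omega⟩
  exact lt_of_le_of_ne (h0 0) (Ne.symm key)

/-- The value 0 given to a ratio with zero denominator is harmless: the support is an interval
around 0, so once `z` vanishes at k it vanishes beyond. -/
lemma symDist_succ (hz : z ∈ symDist) (k : ℕ) : z (k + 1) = ratio z k * z k := by
  have h0 := symDist_zero_pos hz
  unfold ratio
  by_cases hk : z k = 0
  · rw [hk, mul_zero]
    by_contra h
    exact hz.2.2.2.out (show (0 : ℤ) ∈ Function.support z from h0.ne') h
      ⟨by positivity, by omega⟩ hk
  · field_simp

lemma ratio_nonneg (hz : z ∈ symDist) (k : ℕ) : 0 ≤ ratio z k :=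
  div_nonneg (hz.1 _) (hz.1 _)

lemma symDist_eq_prod (hz : z ∈ symDist) (i : ℤ) :
    z i = z 0 * ∏ j ∈ Finset.range i.natAbs, ratio z j := by
  have key : ∀ k : ℕ, z k = z 0 * ∏ j ∈ Finset.range k, ratio z j := by
    intro k
    induction k with
    | zero => simp
    | succ k ih =>
      rw [Finset.prod_range_succ, ← mul_assoc, ← ih, mul_comm, ← symDist_succ hz k]
      push_cast; rfl
  rcases Int.natAbs_eq i with h | h
  · conv_lhs => rw [h]
    exact key _
  · conv_lhs => rw [h, hz.2.2.1]
    exact key _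

/-- A sum s of three probabilities lies in [0, 3], so s^d ≤ 3^(d-1) s, which is summable. -/
lemma summable_opA (hz : z ∈ symDist) {d : ℕ} (hd : 1 ≤ d) : Summable (opA d z) := by
  obtain ⟨h0, h1, hs, hc⟩ := hz
  have hle : ∀ i, z i ≤ 1 := fun i => le_hasSum h1 i fun j _ => h0 j
  have hsum : Summable fun i : ℤ => z (i - 1) + z i + z (i + 1) :=
    (((Equiv.subRight (1 : ℤ)).summable_iff.2 h1.summable).add h1.summable).add
      ((Equiv.addRight (1 : ℤ)).summable_iff.2 h1.summable)
  refine Summable.of_nonneg_of_le (fun i => ?_) (fun i => ?_) (hsum.mul_left (3 ^ (d - 1)))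
  · have := h0 (i - 1); have := h0 i; have := h0 (i + 1)
    unfold opA; positivity
  · have h2 := h0 (i - 1); have h3 := h0 i; have h4 := h0 (i + 1)
    unfold opA
    obtain ⟨e, rfl⟩ : ∃ e, d = e + 1 := ⟨d - 1, by omega⟩
    rw [pow_succ, Nat.add_sub_cancel]
    have : z (i - 1) + z i + z (i + 1) ≤ 3 := by linarith [hle (i - 1), hle i, hle (i + 1)]
    gcongr

lemma opA_nonneg (hz : z ∈ symDist) (d : ℕ) (i : ℤ) : 0 ≤ opA d z i :=
  pow_nonneg (add_nonneg (add_nonneg (hz.1 _) (hz.1 _)) (hz.1 _)) d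

lemma tsum_opA_pos (hz : z ∈ symDist) {d : ℕ} (hd : 1 ≤ d) : 0 < ∑' i, opA d z i := by
  refine (summable_opA hz hd).tsum_pos (opA_nonneg hz d) 0 ?_
  have := symDist_zero_pos hz; have := hz.1 (0 - 1); have := hz.1 (0 + 1)
  unfold opA; positivity

/-- The recursion thickens the support by one on each side, hence keeps it an interval. -/
lemma opA_ne_zero_iff (hz : z ∈ symDist) {d : ℕ} (hd : 1 ≤ d) (i : ℤ) :
    opA d z i ≠ 0 ↔ ∃ j, z j ≠ 0 ∧ i - 1 ≤ j ∧ j ≤ i + 1 := by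
  have h2 := hz.1 (i - 1); have h3 := hz.1 i; have h4 := hz.1 (i + 1)
  unfold opA
  constructor
  · intro h
    by_contra! hcon
    have e1 : z (i - 1) = 0 := by
      by_contra h'; have := hcon _ h' (by omega); omega
    have e2 : z i = 0 := by
      by_contra h'; have := hcon _ h' (by omega); omega
    have e3 : z (i + 1) = 0 := by
      by_contra h'; have := hcon _ h' (by omega); omega
    apply h
    rw [e1, e2, e3]
    simp; omega
  · rintro ⟨j, hj, hj1, hj2⟩
    have hpos : 0 < z j := lt_of_le_of_ne (hz.1 j) (Ne.symm hj)
    have : j = i - 1 ∨ j = i ∨ j = i + 1 := by omega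
    apply pow_ne_zero
    rcases this with rfl | rfl | rfl <;> positivity

lemma opF_mem_symDist (hz : z ∈ symDist) {d : ℕ} (hd : 1 ≤ d) : opF d z ∈ symDist := by
  have hS := tsum_opA_pos hz hd
  refine ⟨fun i => div_nonneg (opA_nonneg hz d i) hS.le, ?_, fun i => ?_, ?_⟩
  · have := (summable_opA hz hd).hasSum.div_const (∑' i, opA d z i)
    rwa [div_self hS.ne'] at this
  · unfold opF
    congr 1
    unfold opA
    rw [show -i - 1 = -(i + 1) by ring, show -i + 1 = -(i - 1) by ring, hz.2.2.1, hz.2.2.1,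
      hz.2.2.1]
    ring
  · have hsupp : Function.support (opF d z) = Function.support (opA d z) := by
      ext i
      simp [opF, hS.ne']
    rw [hsupp]
    constructor
    intro i hi j hj k hk
    obtain ⟨i', hi', hi1, hi2⟩ := (opA_ne_zero_iff hz hd i).1 hi
    obtain ⟨j', hj', hj1, hj2⟩ := (opA_ne_zero_iff hz hd j).1 hj
    refine (opA_ne_zero_iff hz hd k).2 ?_
    obtain ⟨hk1, hk2⟩ := hk
    by_cases h1 : k < i'
    · exact ⟨i', hi', by omega, by omega⟩
    by_cases h2 : j' < k
    · exact ⟨j', hj', by omega, by omega⟩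
    · exact ⟨k, hz.2.2.2.out hi' hj' ⟨by omega, by omega⟩, by omega, by omega⟩

/-- The normalizing sum cancels in each quotient. At coordinate 0 the symmetry z_{-1} = z_1 produces
the denominator 1 + 2 x_0; at coordinate k + 1 one divides through by z_k. -/
lemma ratio_opF (hz : z ∈ symDist) {d : ℕ} (hd : 1 ≤ d) :
    ratio (opF d z) = ratioStep d (ratio z) := by
  have hS := tsum_opA_pos hz hd
  have hdiv : ∀ k, ratio (opF d z) k = opA d z (k + 1) / opA d z k := fun k => by
    unfold ratio opF
    rw [div_div_div_cancel_right₀ hS.ne']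
  have hz0 := symDist_zero_pos hz
  funext k
  rw [hdiv]
  unfold opA
  rw [← div_pow]
  cases k with
  | zero =>
    unfold ratioStep
    congr 1
    have e1 := symDist_succ hz 0
    have e2 := symDist_succ hz 1
    have e3 := hz.2.2.1 1
    have h0 := ratio_nonneg hz 0
    norm_num at e1 e2 e3 ⊢
    rw [e3, e2, e1]
    field_simp
    ring
  | succ k =>
    unfold ratioStep
    congr 1
    have e1 := symDist_succ hz k
    have e2 := symDist_succ hz (k + 1)
    have e3 := symDist_succ hz (k + 2)
    have h0 := ratio_nonneg hz k
    have h1 := ratio_nonneg hz (k + 1)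
    push_cast at e1 e2 e3 ⊢
    rw [show (k : ℤ) + 1 + 1 - 1 = k + 1 by ring, show (k : ℤ) + 1 - 1 = k by ring]
    rw [show (k : ℤ) + 2 = k + 1 + 1 by ring] at e3
    rw [e3, e2, e1]
    by_cases hk : z k = 0
    · have : ratio z k = 0 := by unfold ratio; rw [hk, div_zero]
      rw [hk, this]; simp
    · field_simp

end symDist

lemma single_mem_symDist : (Pi.single 0 1 : ℤ → ℝ) ∈ symDist := by
  refine ⟨fun i => ?_, hasSum_pi_single 0 1, fun i => ?_, ?_⟩
  · by_cases h : i = 0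
    · subst h; simp
    · simp [h]
  · by_cases h : i = 0
    · subst h; simp
    · simp [h]
  · have : Function.support (Pi.single 0 1 : ℤ → ℝ) = {0} := by
      ext i
      by_cases h : i = 0
      · subst h; simp
      · simp [h]
    rw [this]
    exact Set.ordConnected_singleton

lemma ratio_single : ratio (Pi.single 0 1) = 0 := by
  funext k
  have : ((k : ℤ) + 1) ≠ 0 := by omega
  simp [ratio, this]

lemma iterate_opF_mem_symDist {d : ℕ} (hd : 1 ≤ d) (n : ℕ) :
    (opF d)^[n] (Pi.single 0 1) ∈ symDist := by
  induction n with
  | zero => exact single_mem_symDist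
  | succ n ih => rw [Function.iterate_succ_apply']; exact opF_mem_symDist ih hd

lemma ratio_iterate_opF {d : ℕ} (hd : 1 ≤ d) (n : ℕ) :
    ratio ((opF d)^[n] (Pi.single 0 1)) = (ratioStep d)^[n] 0 := by
  induction n with
  | zero => exact ratio_single
  | succ n ih =>
    rw [Function.iterate_succ_apply', Function.iterate_succ_apply',
      ratio_opF (iterate_opF_mem_symDist hd n) hd, ih]

lemma zero_mem_ratioSet : (0 : ℕ → ℝ) ∈ ratioSet := ⟨_, single_mem_symDist, ratio_single⟩

lemma ratioSet_nonneg {x : ℕ → ℝ} (hx : x ∈ ratioSet) (k : ℕ) : 0 ≤ x k := by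
  obtain ⟨z, hz, rfl⟩ := hx
  exact ratio_nonneg hz k

/-- Injectivity of `ratio` plays no role: by `ratio_opF` every preimage of `x` leads to the same
ratios after one step. -/
lemma psi_eq_ratioStep {d : ℕ} (hd : 1 ≤ d) {x : ℕ → ℝ} (hx : x ∈ ratioSet) :
    psi d x = ratioStep d x := by
  unfold psi
  rw [ratio_opF (Function.invFunOn_mem hx) hd, Function.invFunOn_eq hx]

lemma psi_mem_ratioSet {d : ℕ} (hd : 1 ≤ d) {x : ℕ → ℝ} (hx : x ∈ ratioSet) :
    psi d x ∈ ratioSet :=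
  ⟨_, opF_mem_symDist (Function.invFunOn_mem hx) hd, rfl⟩

/-! ### Monotonicity of the recursion and invariant boxes -/

/-- Nonnegative sequences with first coordinate in `[a, b]` and the others at most `c`. -/
def ratioBox (a b c : ℝ) : Set (ℕ → ℝ) :=
  {x | (∀ k, 0 ≤ x k) ∧ a ≤ x 0 ∧ x 0 ≤ b ∧ ∀ k, x (k + 1) ≤ c}

lemma mem_envelope_iff {a b c : ℝ} {x : ℕ → ℝ} :
    x ∈ envelope a b c ↔ x ∈ ratioSet ∧ x ∈ ratioBox a b c := by
  constructor
  · rintro ⟨h, ha, hb, hc⟩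
    exact ⟨h, ratioSet_nonneg h, ha, hb, fun k => (hc (k + 1) (by omega)).2⟩
  · rintro ⟨h, h0, ha, hb, hc⟩
    refine ⟨h, ha, hb, fun k hk => ⟨h0 k, ?_⟩⟩
    obtain ⟨j, rfl⟩ : ∃ j, k = j + 1 := ⟨k - 1, by omega⟩
    exact hc j

lemma ratioStep_nonneg {d : ℕ} {x : ℕ → ℝ} (hx : ∀ k, 0 ≤ x k) (k : ℕ) :
    0 ≤ ratioStep d x k := by
  cases k with
  | zero => have := hx 0; have := hx 1; unfold ratioStep; positivity
  | succ k =>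
    have := hx k; have := hx (k + 1); have := hx (k + 2); unfold ratioStep; positivity

lemma le_ratioStep_zero {d : ℕ} {x : ℕ → ℝ} (hx : ∀ k, 0 ≤ x k) {b : ℝ} (hb : x 0 ≤ b) :
    ((1 + b) / (1 + 2 * b)) ^ d ≤ ratioStep d x 0 := by
  have h0 := hx 0
  have h1 := hx 1
  have hb0 : 0 ≤ b := h0.trans hb
  unfold ratioStep
  refine pow_le_pow_left₀ (by positivity) ?_ d
  rw [div_le_div_iff₀ (by positivity) (by positivity)]
  nlinarith [mul_nonneg h0 h1, mul_nonneg (mul_nonneg h0 h1) hb0]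

lemma ratioStep_zero_le {d : ℕ} {x : ℕ → ℝ} (hx : ∀ k, 0 ≤ x k) {a c : ℝ} (ha0 : 0 ≤ a)
    (ha : a ≤ x 0) (hc : x 1 ≤ c) (hc1 : c ≤ 1) :
    ratioStep d x 0 ≤ ((1 + a + a * c) / (1 + 2 * a)) ^ d := by
  have h0 := hx 0
  have h1 := hx 1
  unfold ratioStep
  refine pow_le_pow_left₀ (by positivity) ?_ d
  have hc0 : 0 ≤ c := h1.trans hc
  calc (1 + x 0 + x 0 * x 1) / (1 + 2 * x 0) ≤ (1 + x 0 + x 0 * c) / (1 + 2 * x 0) := by gcongr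
    _ ≤ _ := by
      rw [div_le_div_iff₀ (by positivity) (by positivity)]
      nlinarith [mul_nonneg (sub_nonneg.2 ha) (sub_nonneg.2 hc1)]

/-- The variables are raised one at a time, in the order r, p, q. -/
lemma ratioQuotient_mono {p q r p' q' r' : ℝ} (hp : 0 ≤ p) (hq : 0 ≤ q) (hr : 0 ≤ r)
    (hpp : p ≤ p') (hqq : q ≤ q') (hrr : r ≤ r') :
    p * (1 + q + q * r) / (1 + p + p * q) ≤
      p' * (1 + q' + q' * r') / (1 + p' + p' * q') := by
  have hp' : 0 ≤ p' := hp.trans hpp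
  have hq' : 0 ≤ q' := hq.trans hqq
  have hr' : 0 ≤ r' := hr.trans hrr
  calc p * (1 + q + q * r) / (1 + p + p * q)
      ≤ p * (1 + q + q * r') / (1 + p + p * q) := by gcongr
    _ ≤ p' * (1 + q + q * r') / (1 + p' + p' * q) := by
      rw [div_le_div_iff₀ (by positivity) (by positivity)]
      have : 0 ≤ (p' - p) * (1 + q + q * r') := mul_nonneg (sub_nonneg.2 hpp) (by positivity)
      nlinarith
    _ ≤ p' * (1 + q' + q' * r') / (1 + p' + p' * q') := by
      rw [mul_div_assoc, mul_div_assoc]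
      refine mul_le_mul_of_nonneg_left ?_ hp'
      rw [div_le_div_iff₀ (by positivity) (by positivity)]
      have : 0 ≤ (q' - q) * (1 + r' + r' * p') := mul_nonneg (sub_nonneg.2 hqq) (by positivity)
      nlinarith

lemma ratioStep_one_le {d : ℕ} {x : ℕ → ℝ} (hx : ∀ k, 0 ≤ x k) {b c : ℝ}
    (hb : x 0 ≤ b) (hc : ∀ k, x (k + 1) ≤ c) :
    ratioStep d x 1 ≤ (b * (1 + c + c * c) / (1 + b + b * c)) ^ d := by
  have h0 := hx 0
  have h1 := hx 1
  have h2 := hx 2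
  refine pow_le_pow_left₀ (by positivity) ?_ d
  exact ratioQuotient_mono h0 h1 h2 hb (hc 0) (hc 1)

/-- At the corner p = q = r = c the quotient collapses to c. -/
lemma ratioStep_add_two_le {d : ℕ} {x : ℕ → ℝ} (hx : ∀ k, 0 ≤ x k) {c : ℝ}
    (hc : ∀ k, x (k + 1) ≤ c) (k : ℕ) :
    ratioStep d x (k + 2) ≤ c ^ d := by
  have h0 := hx (k + 1)
  have h1 := hx (k + 2)
  have h2 := hx (k + 3)
  have hc0 : 0 ≤ c := h0.trans (hc k)
  refine pow_le_pow_left₀ (by positivity) ?_ d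
  refine (ratioQuotient_mono h0 h1 h2 (hc k) (hc (k + 1)) (hc (k + 2))).trans_eq ?_
  field_simp

lemma ratioStep_mem_ratioBox {d : ℕ} {a b c a' b' c' : ℝ} {x : ℕ → ℝ}
    (hx : x ∈ ratioBox a b c) (ha : 0 ≤ a) (hc : c ≤ 1)
    (ha' : a' ≤ ((1 + b) / (1 + 2 * b)) ^ d)
    (hb' : ((1 + a + a * c) / (1 + 2 * a)) ^ d ≤ b')
    (hc1 : (b * (1 + c + c * c) / (1 + b + b * c)) ^ d ≤ c') (hc2 : c ^ d ≤ c') :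
    ratioStep d x ∈ ratioBox a' b' c' := by
  obtain ⟨h0, hxa, hxb, hxc⟩ := hx
  refine ⟨ratioStep_nonneg h0, ha'.trans (le_ratioStep_zero h0 hxb),
    (ratioStep_zero_le h0 ha hxa (hxc 0) hc).trans hb', fun k => ?_⟩
  cases k with
  | zero => exact (ratioStep_one_le h0 hxb hxc).trans hc1
  | succ k => exact (ratioStep_add_two_le h0 hxc k).trans hc2

/-! ### The two basins for `8 ≤ d` -/

lemma pow_le_hundredth {d : ℕ} (hd : 8 ≤ d) {t : ℝ} (h0 : 0 ≤ t) (ht : t ≤ 0.51) :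
    t ^ d ≤ 0.01 :=
  calc t ^ d ≤ t ^ 8 := pow_le_pow_of_le_one h0 (by linarith) hd
    _ ≤ 0.51 ^ 8 := pow_le_pow_left₀ h0 ht 8
    _ ≤ 0.01 := by norm_num

lemma ratioStep_upper_mem {d : ℕ} (hd : 8 ≤ d) {x : ℕ → ℝ} (hx : x ∈ ratioBox 0.4 1 0.01) :
    ratioStep d x ∈ ratioBox 0 (0.78 ^ d) 0.01 := by
  refine ratioStep_mem_ratioBox hx (by norm_num) (by norm_num) (by positivity) ?_ ?_ ?_
  -- This is where 0.78 comes from: (1 + 0.4 + 0.4 · 0.01) / (1 + 2 · 0.4) is exactly 0.78.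
  · norm_num
  · exact pow_le_hundredth hd (by norm_num) (by norm_num)
  · exact pow_le_hundredth hd (by norm_num) (by norm_num)

/-- Feeds Bernoulli's inequality in `two_fifths_le`; the bound already fails at d = 12. -/
lemma nat_mul_pow_le {d : ℕ} (hd : 13 ≤ d) : (d : ℝ) * 0.78 ^ d ≤ 0.6 := by
  induction d, hd using Nat.le_induction with
  | base => norm_num
  | succ n hn ih =>
    have h12 : (13 : ℝ) ≤ n := by exact_mod_cast hn
    have hp : (0 : ℝ) ≤ 0.78 ^ n := by positivity
    rw [pow_succ]
    push_cast
    nlinarith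

lemma pow_le_of_eight_le {d : ℕ} (hd : 8 ≤ d) : (0.78 : ℝ) ^ d ≤ 0.14 :=
  (pow_le_pow_of_le_one (by norm_num) (by norm_num) hd).trans (by norm_num)

/-- With t = 0.78^d, Bernoulli gives (1 - t/(1+2t))^d ≥ 1 - d t, which is at least 0.4 from d = 13
on. Smaller d are computed directly; at d = 8 the value is only about 0.4025. -/
lemma two_fifths_le {d : ℕ} (hd : 8 ≤ d) :
    (0.4 : ℝ) ≤ ((1 + 0.78 ^ d) / (1 + 2 * 0.78 ^ d)) ^ d := by
  by_cases h : d < 13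
  · interval_cases d <;> norm_num
  · have h1 := nat_mul_pow_le (d := d) (by omega)
    set t : ℝ := 0.78 ^ d with ht
    have ht0 : 0 < t := by positivity
    have ht1 : t ≤ 0.14 := pow_le_of_eight_le hd
    have hq : (1 + t) / (1 + 2 * t) = 1 + -(t / (1 + 2 * t)) := by field_simp; ring
    have hle : t / (1 + 2 * t) ≤ t := div_le_self ht0.le (by linarith)
    rw [hq]
    refine le_trans ?_ (one_add_mul_le_pow (by linarith) d)
    have : (d : ℝ) * (t / (1 + 2 * t)) ≤ d * t := by gcongr
    linarith

lemma ratioStep_lower_mem {d : ℕ} (hd : 8 ≤ d) {x : ℕ → ℝ}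
    (hx : x ∈ ratioBox 0 (0.78 ^ d) 0.01) : ratioStep d x ∈ ratioBox 0.4 1 0.01 := by
  have ht : (0.78 : ℝ) ^ d ≤ 0.14 := pow_le_of_eight_le hd
  have ht0 : (0 : ℝ) < 0.78 ^ d := by positivity
  refine ratioStep_mem_ratioBox hx le_rfl (by norm_num) (two_fifths_le hd) (by norm_num) ?_ ?_
  · refine pow_le_hundredth hd (by positivity) ?_
    rw [div_le_iff₀ (by positivity)]
    nlinarith
  · exact pow_le_hundredth hd (by norm_num) (by norm_num)

lemma zero_mem_ratioBox {b c : ℝ} (hb : 0 ≤ b) (hc : 0 ≤ c) :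
    (0 : ℕ → ℝ) ∈ ratioBox 0 b c :=
  ⟨fun _ => le_rfl, le_rfl, hb, fun _ => hc⟩

lemma iterate_ratioStep_mem {d : ℕ} (hd : 8 ≤ d) (k : ℕ) :
    (ratioStep d)^[2 * k] 0 ∈ ratioBox 0 (0.78 ^ d) 0.01 ∧
      (ratioStep d)^[2 * k + 1] 0 ∈ ratioBox 0.4 1 0.01 := by
  suffices h : (ratioStep d)^[2 * k] 0 ∈ ratioBox 0 (0.78 ^ d) 0.01 by
    refine ⟨h, ?_⟩
    rw [Function.iterate_succ_apply']
    exact ratioStep_lower_mem hd h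
  induction k with
  | zero => exact zero_mem_ratioBox (by positivity) (by norm_num)
  | succ k ih =>
    rw [show 2 * (k + 1) = 2 * k + 1 + 1 by ring, Function.iterate_succ_apply',
      Function.iterate_succ_apply']
    exact ratioStep_upper_mem hd (ratioStep_lower_mem hd ih)

lemma not_tendsto_iterate_ratioStep_zero {d : ℕ} (hd : 8 ≤ d) (l : ℝ) :
    ¬ Tendsto (fun n => (ratioStep d)^[n] 0 0) atTop (𝓝 l) := by
  intro h
  have h1 : Tendsto (fun k : ℕ => 2 * k) atTop atTop :=
    tendsto_atTop_mono (fun k => by simp only [id]; omega) tendsto_id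
  have h2 : Tendsto (fun k : ℕ => 2 * k + 1) atTop atTop :=
    tendsto_atTop_mono (fun k => by simp only [id]; omega) tendsto_id
  have e1 : l ≤ 0.78 ^ d :=
    le_of_tendsto' (h.comp h1) fun k => (iterate_ratioStep_mem hd k).1.2.2.1
  have e2 : 0.4 ≤ l :=
    ge_of_tendsto' (h.comp h2) fun k => (iterate_ratioStep_mem hd k).2.2.1
  have := pow_le_of_eight_le hd
  linarith

lemma mapsTo_psi_upperBasin {d : ℕ} (hd : 8 ≤ d) :
    Set.MapsTo (psi d) upperBasin (lowerBasin d) := by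
  intro x hx
  obtain ⟨hR, hB⟩ := mem_envelope_iff.1 hx
  refine mem_envelope_iff.2 ⟨psi_mem_ratioSet (by omega) hR, ?_⟩
  rw [psi_eq_ratioStep (by omega) hR]
  exact ratioStep_upper_mem hd hB

lemma mapsTo_psi_lowerBasin {d : ℕ} (hd : 8 ≤ d) :
    Set.MapsTo (psi d) (lowerBasin d) upperBasin := by
  intro x hx
  obtain ⟨hR, hB⟩ := mem_envelope_iff.1 hx
  refine mem_envelope_iff.2 ⟨psi_mem_ratioSet (by omega) hR, ?_⟩
  rw [psi_eq_ratioStep (by omega) hR]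
  exact ratioStep_lower_mem hd hB

lemma basin_gap {d : ℕ} (hd : 8 ≤ d) {x y : ℕ → ℝ} (hx : x ∈ upperBasin)
    (hy : y ∈ lowerBasin d) : 0.26 ≤ x 0 - y 0 := by
  have h1 := hx.2.1
  have h2 := hy.2.2.1
  have h3 := pow_le_of_eight_le hd
  linarith

lemma iterate_psi {d : ℕ} (hd : 1 ≤ d) (n : ℕ) :
    (psi d)^[n] 0 ∈ ratioSet ∧ (psi d)^[n] 0 = (ratioStep d)^[n] 0 := by
  induction n with
  | zero => exact ⟨zero_mem_ratioSet, rfl⟩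
  | succ n ih =>
    rw [Function.iterate_succ_apply', Function.iterate_succ_apply', ← ih.2]
    exact ⟨psi_mem_ratioSet hd ih.1, psi_eq_ratioStep hd ih.1⟩

lemma iterate_psi_mem {d : ℕ} (hd : 8 ≤ d) (k : ℕ) :
    (psi d)^[2 * k] 0 ∈ lowerBasin d ∧ (psi d)^[2 * k + 1] 0 ∈ upperBasin := by
  have h1 := iterate_psi (d := d) (by omega) (2 * k)
  have h2 := iterate_psi (d := d) (by omega) (2 * k + 1)
  have h3 := iterate_ratioStep_mem hd k
  exact ⟨mem_envelope_iff.2 ⟨h1.1, h1.2 ▸ h3.1⟩, mem_envelope_iff.2 ⟨h2.1, h2.2 ▸ h3.2⟩⟩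

lemma not_tendsto_iterate_psi {d : ℕ} (hd : 8 ≤ d) :
    ¬ ∃ x : ℕ → ℝ, Tendsto (fun n => (psi d)^[n] 0) atTop (𝓝 x) := by
  rintro ⟨x, hx⟩
  refine not_tendsto_iterate_ratioStep_zero hd (x 0) ?_
  refine (tendsto_pi_nhds.1 hx 0).congr fun n => ?_
  rw [(iterate_psi (d := d) (by omega) n).2]

/-! ### Contraction of the recursion on small boxes -/

lemma abs_pow_sub_pow_le_of_le {u v M : ℝ} (hu : 0 ≤ u) (hv : 0 ≤ v) (huM : u ≤ M) (hvM : v ≤ M)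
    (d : ℕ) : |u ^ d - v ^ d| ≤ d * M ^ (d - 1) * |u - v| := by
  refine (abs_pow_sub_pow_le u v d).trans ?_
  rw [abs_of_nonneg hu, abs_of_nonneg hv]
  have h : max u v ^ (d - 1) ≤ M ^ (d - 1) :=
    pow_le_pow_left₀ (le_max_of_le_left hu) (max_le huM hvM) _
  calc |u - v| * d * max u v ^ (d - 1) ≤ |u - v| * d * M ^ (d - 1) := by gcongr
    _ = _ := by ring

/-- Exact telescoping: p is changed first, then q. The first coefficient has numerator q - 1, of
absolute value at most 1. -/
lemma abs_rootQuotient_sub_le {a b c p p' q q' : ℝ} (ha : 0 ≤ a) (hp : a ≤ p) (hp' : a ≤ p')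
    (hpb' : p' ≤ b) (hq : 0 ≤ q) (hqc : q ≤ c) (hc : c ≤ 1) :
    |(1 + p + p * q) / (1 + 2 * p) - (1 + p' + p' * q') / (1 + 2 * p')| ≤
      |p - p'| / (1 + 2 * a) ^ 2 + b / (1 + 2 * b) * |q - q'| := by
  have p0 := ha.trans hp
  have p0' := ha.trans hp'
  have b0 := p0'.trans hpb'
  have e : (1 + p + p * q) / (1 + 2 * p) - (1 + p' + p' * q') / (1 + 2 * p') =
      (p - p') * ((q - 1) / ((1 + 2 * p) * (1 + 2 * p'))) + p' / (1 + 2 * p') * (q - q') := by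
    field_simp
    ring
  rw [e]
  refine (abs_add_le _ _).trans ?_
  rw [abs_mul, abs_mul, abs_of_nonneg (show 0 ≤ p' / (1 + 2 * p') by positivity)]
  refine add_le_add ?_ (mul_le_mul_of_nonneg_right ?_ (abs_nonneg _))
  · rw [div_eq_mul_inv |p - p'|]
    refine mul_le_mul_of_nonneg_left ?_ (abs_nonneg _)
    rw [abs_div, abs_of_pos (show 0 < (1 + 2 * p) * (1 + 2 * p') by positivity),
      abs_of_nonpos (by linarith), ← one_div]
    apply div_le_div₀ zero_le_one (by linarith) (by positivity)
    rw [sq]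
    gcongr
  · rw [div_le_div_iff₀ (by positivity) (by positivity)]
    nlinarith

/-- The same telescoping in three variables, changing p, then q, then r; every denominator is
bounded below through 1 + α. -/
lemma abs_ratioQuotient_sub_le {α β γ p p' q q' r r' : ℝ} (hα : 0 ≤ α)
    (hp : α ≤ p) (hp' : α ≤ p') (hpβ' : p' ≤ β)
    (hq : 0 ≤ q) (hq' : 0 ≤ q') (hqγ : q ≤ γ) (hqγ' : q' ≤ γ) (hr : 0 ≤ r) (hrγ : r ≤ γ) :
    |p * (1 + q + q * r) / (1 + p + p * q) - p' * (1 + q' + q' * r') / (1 + p' + p' * q')| ≤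
      (1 + γ + γ * γ) / (1 + α) ^ 2 * |p - p'| +
        β * (1 + γ + γ * β) / (1 + α) ^ 2 * |q - q'| + β * γ * |r - r'| := by
  have p0 := hα.trans hp
  have p0' := hα.trans hp'
  have g0 := hq.trans hqγ
  have b0 := p0'.trans hpβ'
  have e : p * (1 + q + q * r) / (1 + p + p * q) -
      p' * (1 + q' + q' * r') / (1 + p' + p' * q') =
      (1 + q + q * r) / ((1 + p + p * q) * (1 + p' + p' * q)) * (p - p') +
      p' * (1 + r + r * p') / ((1 + p' + p' * q) * (1 + p' + p' * q')) * (q - q') +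
      p' * q' / (1 + p' + p' * q') * (r - r') := by
    field_simp
    ring
  have hD : ∀ {s t : ℝ}, α ≤ s → 0 ≤ t → 1 + α ≤ 1 + s + s * t := fun hs ht => by
    have := mul_nonneg (hα.trans hs) ht
    linarith
  have h1 := hD hp hq
  have h2 := hD hp' hq
  have h3 := hD hp' hq'
  rw [e]
  refine (abs_add_three _ _ _).trans ?_
  rw [abs_mul, abs_mul, abs_mul,
    abs_of_nonneg (show 0 ≤ (1 + q + q * r) / ((1 + p + p * q) * (1 + p' + p' * q)) by positivity),
    abs_of_nonneg (show 0 ≤ p' * (1 + r + r * p') /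
      ((1 + p' + p' * q) * (1 + p' + p' * q')) by positivity),
    abs_of_nonneg (show 0 ≤ p' * q' / (1 + p' + p' * q') by positivity)]
  gcongr ?_ * _ + ?_ * _ + ?_ * _
  · rw [sq]
    gcongr
  · rw [sq]
    gcongr
  · calc p' * q' / (1 + p' + p' * q') ≤ p' * q' := div_le_self (by positivity) (by nlinarith)
      _ ≤ β * γ := by gcongr

/-- Numerical conditions under which `ratioStep d` contracts by the factor `K` on
`ratioBox a b c`, for the sup norm in which the first coordinate has weight `1 / w`. -/
structure ContractsOn (d : ℕ) (a b c w K : ℝ) : Prop where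
  nonneg : 0 ≤ a
  c_nonneg : 0 ≤ c
  c_le : c ≤ 1
  w_pos : 0 < w
  root : d * ((1 + a + a * c) / (1 + 2 * a)) ^ (d - 1) *
    (w / (1 + 2 * a) ^ 2 + b / (1 + 2 * b)) ≤ K * w
  first : d * (b * (1 + c + c * c) / (1 + b + b * c)) ^ (d - 1) *
    ((1 + c + c * c) / (1 + a) ^ 2 * w + b * (1 + c + c * b) / (1 + a) ^ 2 + b * c) ≤ K
  tail : d * c ^ (d - 1) * ((1 + c + c * c) + c * (1 + c + c * c) + c * c) ≤ K

/-- The bound |u^d - v^d| ≤ d M^(d-1) |u - v| is combined with the quotient estimates; `root`,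
`first` and `tail` are the resulting row sums. A large w damps the effect of x_1 on the root row, at
the price of a factor w on x_0 in the `first` row. -/
lemma ContractsOn.abs_sub_le {d : ℕ} {a b c w K : ℝ} (h : ContractsOn d a b c w K)
    {x y : ℕ → ℝ} (hx : x ∈ ratioBox a b c) (hy : y ∈ ratioBox a b c) {δ : ℝ}
    (h0 : |x 0 - y 0| ≤ w * δ) (h1 : ∀ k, |x (k + 1) - y (k + 1)| ≤ δ) :
    |ratioStep d x 0 - ratioStep d y 0| ≤ w * (K * δ) ∧
      ∀ k, |ratioStep d x (k + 1) - ratioStep d y (k + 1)| ≤ K * δ := by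
  obtain ⟨xn, xa, xb, xc⟩ := hx
  obtain ⟨yn, ya, yb, yc⟩ := hy
  obtain ⟨ha, hc0, hc1, hw, hroot, hfirst, htail⟩ := h
  have hδ : 0 ≤ δ := (abs_nonneg _).trans (h1 0)
  have hb : 0 ≤ b := ha.trans (xa.trans xb)
  refine ⟨?_, fun k => ?_⟩
  · have key : ∀ z : ℕ → ℝ, (∀ k, 0 ≤ z k) → a ≤ z 0 → z 1 ≤ c →
        0 ≤ (1 + z 0 + z 0 * z 1) / (1 + 2 * z 0) ∧
        (1 + z 0 + z 0 * z 1) / (1 + 2 * z 0) ≤ (1 + a + a * c) / (1 + 2 * a) := by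
      intro z zn za zc
      have z0 := zn 0
      have z1 := zn 1
      refine ⟨by positivity, ?_⟩
      -- Exponent 1 turns the bound on `ratioStep` into a bound on the bare quotient.
      have := ratioStep_zero_le (d := 1) zn ha za zc hc1
      simpa [ratioStep] using this
    obtain ⟨ux, uM⟩ := key x xn xa (xc 0)
    obtain ⟨vx, vM⟩ := key y yn ya (yc 0)
    refine (abs_pow_sub_pow_le_of_le ux vx uM vM d).trans ?_
    have hB : 0 ≤ (1 + a + a * c) / (1 + 2 * a) := by positivity
    have hd : |(1 + x 0 + x 0 * x 1) / (1 + 2 * x 0) - (1 + y 0 + y 0 * y 1) / (1 + 2 * y 0)| ≤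
        (w / (1 + 2 * a) ^ 2 + b / (1 + 2 * b)) * δ := by
      refine (abs_rootQuotient_sub_le ha xa ya yb (xn 1) (xc 0) hc1).trans ?_
      have hh : w / (1 + 2 * a) ^ 2 * δ = w * δ / (1 + 2 * a) ^ 2 := by ring
      rw [add_mul, hh]
      have := h1 0
      gcongr
    calc _ ≤ d * ((1 + a + a * c) / (1 + 2 * a)) ^ (d - 1) *
          ((w / (1 + 2 * a) ^ 2 + b / (1 + 2 * b)) * δ) := by gcongr
      _ ≤ K * w * δ := by rw [← mul_assoc]; gcongr
      _ = _ := by ring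
  · cases k with
    | zero =>
      have key : ∀ z : ℕ → ℝ, (∀ k, 0 ≤ z k) → z 0 ≤ b → z 1 ≤ c → z 2 ≤ c →
          0 ≤ z 0 * (1 + z 1 + z 1 * z 2) / (1 + z 0 + z 0 * z 1) ∧
          z 0 * (1 + z 1 + z 1 * z 2) / (1 + z 0 + z 0 * z 1) ≤
            b * (1 + c + c * c) / (1 + b + b * c) := by
        intro z zn zb zc zc'
        have z0 := zn 0
        have z1 := zn 1
        have z2 := zn 2
        exact ⟨by positivity, ratioQuotient_mono z0 z1 z2 zb zc zc'⟩
      obtain ⟨ux, uM⟩ := key x xn xb (xc 0) (xc 1)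
      obtain ⟨vx, vM⟩ := key y yn yb (yc 0) (yc 1)
      refine (abs_pow_sub_pow_le_of_le ux vx uM vM d).trans ?_
      have hB : 0 ≤ b * (1 + c + c * c) / (1 + b + b * c) := by positivity
      refine le_trans (mul_le_mul_of_nonneg_left (c := ((1 + c + c * c) / (1 + a) ^ 2 * w +
        b * (1 + c + c * b) / (1 + a) ^ 2 + b * c) * δ) ?_ ?_) ?_
      · refine (abs_ratioQuotient_sub_le ha xa ya yb (xn 1) (yn 1) (xc 0) (yc 0) (xn 2)
          (xc 1)).trans ?_
        rw [add_mul, add_mul, mul_assoc _ w]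
        have := h1 0
        have := h1 1
        gcongr
      · positivity
      · rw [← mul_assoc]
        gcongr
    | succ k =>
      have key : ∀ z : ℕ → ℝ, (∀ k, 0 ≤ z k) → (∀ k, z (k + 1) ≤ c) →
          0 ≤ z (k + 1) * (1 + z (k + 2) + z (k + 2) * z (k + 3)) /
            (1 + z (k + 1) + z (k + 1) * z (k + 2)) ∧
          z (k + 1) * (1 + z (k + 2) + z (k + 2) * z (k + 3)) /
            (1 + z (k + 1) + z (k + 1) * z (k + 2)) ≤ c := by
        intro z zn zc
        have z0 := zn (k + 1)
        have z1 := zn (k + 2)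
        have z2 := zn (k + 3)
        refine ⟨by positivity, ?_⟩
        have := ratioStep_add_two_le (d := 1) zn zc k
        simpa [ratioStep] using this
      obtain ⟨ux, uM⟩ := key x xn xc
      obtain ⟨vx, vM⟩ := key y yn yc
      refine (abs_pow_sub_pow_le_of_le ux vx uM vM d).trans ?_
      refine le_trans (mul_le_mul_of_nonneg_left (c := ((1 + c + c * c) +
        c * (1 + c + c * c) + c * c) * δ) ?_ ?_) ?_
      · refine (abs_ratioQuotient_sub_le le_rfl (xn (k + 1)) (yn (k + 1)) (yc k) (xn (k + 2))
          (yn (k + 2)) (xc (k + 1)) (yc (k + 1)) (xn (k + 3)) (xc (k + 2))).trans ?_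
        rw [add_mul, add_mul, add_zero, one_pow, div_one, div_one]
        have := h1 k
        have := h1 (k + 1)
        have := h1 (k + 2)
        gcongr
      · positivity
      · rw [← mul_assoc]
        gcongr

lemma ContractsOn.exists_tendsto {d : ℕ} {a b c w K : ℝ} (h : ContractsOn d a b c w K)
    (hK : K < 1) (hb : b ≤ w) {x : ℕ → ℝ} (hx : ∀ n, (ratioStep d)^[n] x ∈ ratioBox a b c)
    (k : ℕ) : ∃ l, Tendsto (fun n => (ratioStep d)^[n] x k) atTop (𝓝 l) := by
  have hstep : ∀ n, |(ratioStep d)^[n] x 0 - (ratioStep d)^[n + 1] x 0| ≤ w * K ^ n ∧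
      ∀ k, |(ratioStep d)^[n] x (k + 1) - (ratioStep d)^[n + 1] x (k + 1)| ≤ K ^ n := by
    intro n
    induction n with
    | zero =>
      have hx0 := hx 0
      have hx1 := hx 1
      obtain ⟨n0, a0, b0, c0⟩ := hx0
      obtain ⟨n1, a1, b1, c1⟩ := hx1
      have hc := h.c_le
      refine ⟨?_, fun k => ?_⟩
      · rw [pow_zero, mul_one, abs_le]
        have := n0 0; have := n1 0
        constructor <;> linarith
      · rw [pow_zero, abs_le]
        have := n0 (k + 1); have := n1 (k + 1); have := c0 k; have := c1 k
        constructor <;> linarith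
    | succ n ih =>
      have := h.abs_sub_le (hx n) (hx (n + 1)) ih.1 ih.2
      simp only [← Function.iterate_succ_apply' (ratioStep d)] at this
      rwa [← pow_succ'] at this
  refine cauchySeq_tendsto_of_complete ?_
  cases k with
  | zero => exact cauchySeq_of_le_geometric K w hK fun n => (hstep n).1
  | succ k =>
    refine cauchySeq_of_le_geometric K 1 hK fun n => ?_
    rw [one_mul]
    exact (hstep n).2 k

/-! ### Rigorous enclosure of the orbit of `0` in integer arithmetic -/

/-- One step of interval arithmetic for `ratioStep d`: a triple `(a, b, c)` stands for the box
`ratioBox (a / m) (b / m) (c / m)`. -/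
def boxStep (d m : ℕ) (s : ℕ × ℕ × ℕ) : ℕ × ℕ × ℕ :=
  (m * (m + s.2.1) ^ d / (m + 2 * s.2.1) ^ d,
    m * (m * m + s.1 * m + s.1 * s.2.2) ^ d / (m * m + 2 * s.1 * m) ^ d + 1,
    min m (max
      (m * (s.2.1 * (m * m + s.2.2 * m + s.2.2 * s.2.2)) ^ d /
        (m * (m * m + s.2.1 * m + s.2.1 * s.2.2)) ^ d + 1)
      (m * s.2.2 ^ d / m ^ d + 1)))

/-- An a priori invariant box for all d ≥ 2. At the corner b = 1, c = 1/2 the quotient is exactly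
0.7, and 0.7^2 < 1/2. -/
lemma ratioStep_mem_ratioBox_half {d : ℕ} (hd : 2 ≤ d) {x : ℕ → ℝ}
    (hx : x ∈ ratioBox 0 1 (1 / 2)) : ratioStep d x ∈ ratioBox 0 1 (1 / 2) := by
  have hpow : ∀ t : ℝ, 0 ≤ t → t ≤ 0.7 → t ^ d ≤ 1 / 2 := fun t h0 h1 =>
    (pow_le_pow_of_le_one h0 (by linarith) hd).trans (by nlinarith)
  refine ratioStep_mem_ratioBox hx le_rfl (by norm_num) (by positivity) (by norm_num) ?_ ?_
  · exact hpow _ (by norm_num) (by norm_num)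
  · exact hpow _ (by norm_num) (by norm_num)

lemma iterate_ratioStep_mem_half {d : ℕ} (hd : 2 ≤ d) (n : ℕ) {x : ℕ → ℝ}
    (hx : x ∈ ratioBox 0 1 (1 / 2)) : (ratioStep d)^[n] x ∈ ratioBox 0 1 (1 / 2) := by
  induction n with
  | zero => exact hx
  | succ n ih => rw [Function.iterate_succ_apply']; exact ratioStep_mem_ratioBox_half hd ih

lemma div_le_natDiv_add_one (x y : ℕ) : (x : ℝ) / y ≤ ((x / y + 1 : ℕ) : ℝ) := by
  rw [← Nat.floor_div_eq_div (K := ℝ)]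
  exact_mod_cast (Nat.lt_floor_add_one ((x : ℝ) / y)).le

/-- Lower endpoints are rounded down by integer division and upper ones up by the added 1. The cap
at m keeps c ≤ 1, which the monotonicity of the first coordinate requires; it is legitimate because
later ratios never exceed 1/2. -/
lemma mem_boxStep {d m : ℕ} (hm : 0 < m) (hd : 2 ≤ d) {s : ℕ × ℕ × ℕ} (hs : s.2.2 ≤ m)
    {x : ℕ → ℝ} (hx : x ∈ ratioBox 0 1 (1 / 2))
    (hxs : x ∈ ratioBox ((s.1 : ℝ) / m) ((s.2.1 : ℝ) / m) ((s.2.2 : ℝ) / m)) :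
    ratioStep d x ∈ ratioBox (((boxStep d m s).1 : ℝ) / m) (((boxStep d m s).2.1 : ℝ) / m)
      (((boxStep d m s).2.2 : ℝ) / m) := by
  obtain ⟨a, b, c⟩ := s
  have hm' : (0 : ℝ) < m := by exact_mod_cast hm
  have hc1 : (c : ℝ) / m ≤ 1 := by
    rw [div_le_one hm']; exact_mod_cast hs
  have hmax := ratioStep_mem_ratioBox (d := d)
    (c' := max (((b : ℝ) / m * (1 + (c : ℝ) / m + (c : ℝ) / m * (c / m)) /
      (1 + (b : ℝ) / m + (b : ℝ) / m * (c / m))) ^ d) (((c : ℝ) / m) ^ d))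
    hxs (by positivity) hc1 le_rfl le_rfl (le_max_left _ _) (le_max_right _ _)
  obtain ⟨h0, h1, h2, h3⟩ := hmax
  refine ⟨h0, le_trans ?_ h1, h2.trans ?_, fun k => ?_⟩
  · rw [div_le_iff₀ hm']
    simp only [boxStep]
    refine Nat.cast_div_le.trans_eq ?_
    push_cast
    rw [mul_div_assoc, ← div_pow, mul_comm]
    congr 2
    field_simp
  · rw [le_div_iff₀ hm']
    refine le_trans (le_of_eq ?_) (div_le_natDiv_add_one _ _)
    push_cast
    rw [mul_div_assoc, ← div_pow, mul_comm]
    congr 2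
    field_simp
  · rw [le_div_iff₀ hm']
    simp only [boxStep, Nat.cast_min, Nat.cast_max]
    refine le_min ?_ ?_
    · have := (ratioStep_mem_ratioBox_half hd hx).2.2.2 k
      nlinarith
    · refine (mul_le_mul_of_nonneg_right (h3 k) hm'.le).trans ?_
      rw [max_mul_of_nonneg _ _ hm'.le]
      refine max_le_max ?_ ?_
      · refine le_trans (le_of_eq ?_) (div_le_natDiv_add_one _ _)
        push_cast
        rw [mul_div_assoc (m : ℝ), ← div_pow, mul_comm]
        congr 2
        field_simp
      · refine le_trans (le_of_eq ?_) (div_le_natDiv_add_one _ _)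
        push_cast
        rw [mul_div_assoc, ← div_pow, mul_comm]

lemma mem_iterate_boxStep {d m : ℕ} (hm : 2 ≤ m) (hd : 2 ≤ d) {x : ℕ → ℝ}
    (hx : x ∈ ratioBox 0 1 (1 / 2)) (n : ℕ) :
    ((boxStep d m)^[n] (0, m, m / 2 + 1)).2.2 ≤ m ∧
    (ratioStep d)^[n] x ∈ ratioBox ((((boxStep d m)^[n] (0, m, m / 2 + 1)).1 : ℝ) / m)
      ((((boxStep d m)^[n] (0, m, m / 2 + 1)).2.1 : ℝ) / m)
      ((((boxStep d m)^[n] (0, m, m / 2 + 1)).2.2 : ℝ) / m) := by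
  have hm' : (0 : ℝ) < m := by exact_mod_cast (by omega : 0 < m)
  induction n with
  | zero =>
    obtain ⟨h0, h1, h2, h3⟩ := hx
    refine ⟨by simp only [Function.iterate_zero, id]; omega, h0, ?_, ?_, fun k => ?_⟩
    · simpa using h1
    · simpa [hm'.ne'] using h2
    · have := h3 k
      have h2 : (m : ℝ) ≤ 2 * ((m / 2 + 1 : ℕ) : ℝ) := by exact_mod_cast (by omega)
      simp only [Function.iterate_zero, id]
      rw [le_div_iff₀ hm']
      nlinarith
  | succ n ih =>
    rw [Function.iterate_succ_apply', Function.iterate_succ_apply']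
    exact ⟨min_le_left _ _, mem_boxStep (by omega) hd ih.1 (iterate_ratioStep_mem_half hd n hx) ih.2⟩

lemma exists_tendsto_of_iterate_boxStep {d m : ℕ} (hm : 2 ≤ m) (hd : 2 ≤ d) (N : ℕ)
    {s : ℕ × ℕ × ℕ} (hN : (boxStep d m)^[N] (0, m, m / 2 + 1) = s) {w K : ℝ} (hK : K < 1)
    (hw : (s.2.1 : ℝ) / m ≤ w)
    (h : ContractsOn d ((s.1 : ℝ) / m) ((s.2.1 : ℝ) / m) ((s.2.2 : ℝ) / m) w K) (k : ℕ) :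
    ∃ l, Tendsto (fun n => (ratioStep d)^[n] 0 k) atTop (𝓝 l) := by
  have h0 : (0 : ℕ → ℝ) ∈ ratioBox 0 1 (1 / 2) := zero_mem_ratioBox zero_le_one (by norm_num)
  -- The final box need not be invariant: the iterate of order n + N is the N-step image of a point
  -- of the a priori box, so the enclosure applies to it for every n.
  have hbox : ∀ n, (ratioStep d)^[n] ((ratioStep d)^[N] 0) ∈
      ratioBox ((s.1 : ℝ) / m) ((s.2.1 : ℝ) / m) ((s.2.2 : ℝ) / m) := by
    intro n
    rw [← Function.iterate_add_apply, add_comm, Function.iterate_add_apply, ← hN]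
    exact (mem_iterate_boxStep hm hd (iterate_ratioStep_mem_half hd n h0) N).2
  obtain ⟨l, hl⟩ := h.exists_tendsto hK hw hbox k
  refine ⟨l, (tendsto_add_atTop_iff_nat N).1 ?_⟩
  simpa only [Function.iterate_add_apply] using hl

lemma exists_tendsto_iterate_ratioStep {d : ℕ} (hd : 2 ≤ d) (hd7 : d ≤ 7) (k : ℕ) :
    ∃ l, Tendsto (fun n => (ratioStep d)^[n] 0 k) atTop (𝓝 l) := by
  have hm : 2 ≤ 10 ^ 6 := by norm_num
  have hK : (0.999 : ℝ) < 1 := by norm_num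
  -- Each `s` is the enclosure after the stated number of steps, in units of 10^(-6). More steps are
  -- needed as d grows towards 7, where the root slope is close to -1 and the box must be very small
  -- before the contraction factor drops below 1.
  interval_cases d
  · refine exists_tendsto_of_iterate_boxStep hm le_rfl 8 (s := (512264, 649196, 217841))
      (by decide +kernel) hK (w := 1) ?_ ⟨?_, ?_, ?_, ?_, ?_, ?_, ?_⟩ k <;> norm_num
  · refine exists_tendsto_of_iterate_boxStep hm (by norm_num) 3 (s := (361752, 633906, 109313))
      (by decide +kernel) hK (w := 2) ?_ ⟨?_, ?_, ?_, ?_, ?_, ?_, ?_⟩ k <;> norm_num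
  · refine exists_tendsto_of_iterate_boxStep hm (by norm_num) 4 (s := (284807, 475301, 20045))
      (by decide +kernel) hK (w := 10) ?_ ⟨?_, ?_, ?_, ?_, ?_, ?_, ?_⟩ k <;> norm_num
  · refine exists_tendsto_of_iterate_boxStep hm (by norm_num) 8 (s := (285809, 371578, 1883))
      (by decide +kernel) hK (w := 50) ?_ ⟨?_, ?_, ?_, ?_, ?_, ?_, ?_⟩ k <;> norm_num
  · refine exists_tendsto_of_iterate_boxStep hm (by norm_num) 15 (s := (264611, 328245, 234))
      (by decide +kernel) hK (w := 100) ?_ ⟨?_, ?_, ?_, ?_, ?_, ?_, ?_⟩ k <;> norm_num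
  · refine exists_tendsto_of_iterate_boxStep hm (by norm_num) 75 (s := (257738, 271740, 21))
      (by decide +kernel) hK (w := 500) ?_ ⟨?_, ?_, ?_, ?_, ?_, ?_, ?_⟩ k <;> norm_num

/-! ### Convergence of the law of the height at the root for `2 ≤ d ≤ 7` -/

/-- Makes all limiting ratios positive, hence the limit law positive and its transitions well
defined. Positivity propagates outwards: with ratios at most 1 the quotient is at least x_k / 3. -/
lemma exists_pos_eventually_le {d : ℕ} (hd : 2 ≤ d) (k : ℕ) :
    ∃ ε > 0, ∀ᶠ n in atTop, ε ≤ (ratioStep d)^[n] 0 k := by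
  have hbox : ∀ n, (ratioStep d)^[n] 0 ∈ ratioBox 0 1 (1 / 2) := fun n =>
    iterate_ratioStep_mem_half hd n (zero_mem_ratioBox zero_le_one (by norm_num))
  induction k with
  | zero =>
    refine ⟨((1 + 1) / (1 + 2 * 1)) ^ d, by positivity, ?_⟩
    rw [← eventually_map (P := fun x : ℕ → ℝ => _ ≤ x 0)]
    refine eventually_map.2 ((eventually_ge_atTop 1).mono fun n hn => ?_)
    obtain ⟨m, rfl⟩ : ∃ m, n = m + 1 := ⟨n - 1, by omega⟩
    rw [Function.iterate_succ_apply']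
    exact le_ratioStep_zero (hbox m).1 (hbox m).2.2.1
  | succ k ih =>
    obtain ⟨ε, hε, h⟩ := ih
    refine ⟨(ε / 3) ^ d, by positivity, ?_⟩
    have h' := (tendsto_sub_atTop_nat 1).eventually h
    filter_upwards [h', eventually_ge_atTop 1] with n hn hn1
    obtain ⟨m, rfl⟩ : ∃ m, n = m + 1 := ⟨n - 1, by omega⟩
    rw [Nat.add_sub_cancel] at hn
    rw [Function.iterate_succ_apply']
    have hb := hbox m
    set x := (ratioStep d)^[m] 0
    have h0 := hb.1 k
    have h1 := hb.1 (k + 1)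
    have h2 := hb.1 (k + 2)
    have hk1 : x k ≤ 1 := by
      cases k with
      | zero => exact hb.2.2.1
      | succ k => have := hb.2.2.2 k; linarith
    have hk2 : x (k + 1) ≤ 1 := by have := hb.2.2.2 k; linarith
    refine pow_le_pow_left₀ (by positivity) ?_ d
    apply div_le_div₀ (by positivity) _ (by positivity) (by nlinarith)
    nlinarith [mul_nonneg h1 h2, mul_nonneg h0 (mul_nonneg h1 h2), mul_nonneg h0 h1]

lemma summable_half_pow_natAbs : Summable fun i : ℤ => 2 * (1 / 2 : ℝ) ^ i.natAbs := by
  refine Summable.mul_left 2 (Summable.of_nat_of_neg ?_ ?_) <;>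
  simpa using summable_geometric_two

lemma prod_le_half_pow {x : ℕ → ℝ} (hx : x ∈ ratioBox 0 1 (1 / 2)) (k : ℕ) :
    ∏ j ∈ Finset.range k, x j ≤ 2 * (1 / 2) ^ k := by
  cases k with
  | zero => norm_num
  | succ k =>
    rw [Finset.prod_range_succ']
    have h1 : ∏ j ∈ Finset.range k, x (j + 1) ≤ (1 / 2) ^ k := by
      have := Finset.prod_le_prod (s := Finset.range k) (fun j _ => hx.1 (j + 1))
        (fun j _ => hx.2.2.2 j)
      simpa using this
    have h0 : 0 ≤ ∏ j ∈ Finset.range k, x (j + 1) := Finset.prod_nonneg fun j _ => hx.1 _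
    have := hx.2.2.1
    have := hx.1 0
    rw [pow_succ]
    nlinarith

/-- A law is z_0 times the partial products of its ratios, and z_0 is the inverse of their sum. The
products are dominated by 2 · (1/2)^|i|, so the sums converge and no mass escapes. -/
lemma exists_tendsto_iterate_opF {d : ℕ} (hd : 2 ≤ d) (hd7 : d ≤ 7) :
    ∃ p : ℤ → ℝ, (∀ i, 0 < p i) ∧ HasSum p 1 ∧
      ∀ i, Tendsto (fun n => (opF d)^[n] (Pi.single 0 1) i) atTop (𝓝 (p i)) := by
  choose x hx using exists_tendsto_iterate_ratioStep hd hd7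
  have hbox : ∀ n, (ratioStep d)^[n] 0 ∈ ratioBox 0 1 (1 / 2) := fun n =>
    iterate_ratioStep_mem_half hd n (zero_mem_ratioBox zero_le_one (by norm_num))
  have hpos : ∀ k, 0 < x k := fun k => by
    obtain ⟨ε, hε, h⟩ := exists_pos_eventually_le hd k
    exact hε.trans_le (ge_of_tendsto (hx k) h)
  set X : ℕ → ℕ → ℝ := fun n => (ratioStep d)^[n] 0
  set G : ℕ → ℤ → ℝ := fun n i => ∏ j ∈ Finset.range i.natAbs, X n j
  set g : ℤ → ℝ := fun i => ∏ j ∈ Finset.range i.natAbs, x j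
  have hGg : ∀ i, Tendsto (fun n => G n i) atTop (𝓝 (g i)) := fun i =>
    tendsto_finsetProd _ fun j _ => hx j
  have hGn : ∀ n i, 0 ≤ G n i := fun n i => Finset.prod_nonneg fun j _ => (hbox n).1 j
  have hgn : ∀ i, 0 < g i := fun i => Finset.prod_pos fun j _ => hpos j
  have hGle : ∀ n i, G n i ≤ 2 * (1 / 2) ^ i.natAbs := fun n i => prod_le_half_pow (hbox n) _
  have hT : Tendsto (fun n => ∑' i, G n i) atTop (𝓝 (∑' i, g i)) := by
    refine tendsto_tsum_of_dominated_convergence summable_half_pow_natAbs hGg ?_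
    refine Eventually.of_forall fun n i => ?_
    rw [Real.norm_of_nonneg (hGn n i)]
    exact hGle n i
  have hgs : Summable g := Summable.of_nonneg_of_le (fun i => (hgn i).le)
    (fun i => le_of_tendsto' (hGg i) fun n => hGle n i) summable_half_pow_natAbs
  have hS : 0 < ∑' i, g i := hgs.tsum_pos (fun i => (hgn i).le) 0 (hgn 0)
  refine ⟨fun i => g i / ∑' i, g i, fun i => div_pos (hgn i) hS, ?_, fun i => ?_⟩
  · have := hgs.hasSum.div_const (∑' i, g i)
    rwa [div_self hS.ne'] at this
  · refine ((hGg i).div hT hS.ne').congr fun n => ?_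
    have hz := iterate_opF_mem_symDist (d := d) (by omega) n
    have hr := ratio_iterate_opF (d := d) (by omega) n
    set z := (opF d)^[n] (Pi.single 0 1)
    have hzi : ∀ i, z i = z 0 * G n i := fun i => by
      rw [symDist_eq_prod hz i, hr]
    have h1 : z 0 * ∑' i, G n i = 1 := by
      rw [← tsum_mul_left]
      simp_rw [← hzi]
      exact hz.2.1.tsum_eq
    rw [Pi.div_apply, hzi i, eq_one_div_of_mul_eq_one_left h1]
    ring

/-! ### Counting Lipschitz functions with zero boundary values -/

/-- The number of functions in `zeroBoundary d n` with value `i` at the root. -/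
def heightCount (d : ℕ) : ℕ → ℤ → ℕ
  | 0, i => if i = 0 then 1 else 0
  | n + 1, i => (∑ j ∈ Finset.Icc (i - 1) (i + 1), heightCount d n j) ^ d

/-- The transition probabilities from a vertex of height `j` to a child, when the height at the
child has a priori weights `z`. -/
def transition (z : ℤ → ℝ) (j i : ℤ) : ℝ :=
  if i ∈ Finset.Icc (j - 1) (j + 1) then z i / ∑ l ∈ Finset.Icc (j - 1) (j + 1), z l else 0

lemma sum_Icc_sub_one_add_one {M : Type*} [AddCommMonoid M] (f : ℤ → M) (i : ℤ) :
    ∑ j ∈ Finset.Icc (i - 1) (i + 1), f j = f (i - 1) + f i + f (i + 1) := by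
  have : Finset.Icc (i - 1) (i + 1) = {i - 1, i, i + 1} := by
    ext j
    simp only [Finset.mem_Icc, Finset.mem_insert, Finset.mem_singleton]
    omega
  rw [this, Finset.sum_insert (by simp; omega), Finset.sum_insert (by simp), Finset.sum_singleton,
    add_assoc]

lemma exists_heightCount_eq {d : ℕ} (hd : 1 ≤ d) (n : ℕ) :
    ∃ S > 0, ∀ i, (heightCount d n i : ℝ) = S * (opF d)^[n] (Pi.single 0 1) i := by
  induction n with
  | zero =>
    refine ⟨1, one_pos, fun i => ?_⟩
    by_cases h : i = 0
    · subst h; simp [heightCount]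
    · simp [heightCount, h]
  | succ n ih =>
    obtain ⟨S, hS, h⟩ := ih
    have hz := iterate_opF_mem_symDist hd n
    have hT := tsum_opA_pos hz hd
    rw [Function.iterate_succ_apply']
    set z := (opF d)^[n] (Pi.single 0 1)
    refine ⟨S ^ d * ∑' i, opA d z i, by positivity, fun i => ?_⟩
    unfold heightCount opF
    push_cast
    simp_rw [h]
    rw [← Finset.mul_sum, mul_pow, sum_Icc_sub_one_add_one]
    unfold opA at hT ⊢
    field_simp

lemma transition_nonneg {z : ℤ → ℝ} (hz : ∀ i, 0 ≤ z i) (j i : ℤ) : 0 ≤ transition z j i := by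
  unfold transition
  split_ifs
  · exact div_nonneg (hz i) (Finset.sum_nonneg fun l _ => hz l)
  · exact le_rfl

/-- Counts are proportional to F^n(δ_0), so the constant cancels in the transition; if the whole
window has zero weight, both sides vanish. -/
lemma heightCount_eq_transition {d : ℕ} (hd : 1 ≤ d) (n : ℕ) {j i : ℤ}
    (h : i ∈ Finset.Icc (j - 1) (j + 1)) :
    (heightCount d n i : ℝ) = (∑ l ∈ Finset.Icc (j - 1) (j + 1), (heightCount d n l : ℝ)) *
      transition ((opF d)^[n] (Pi.single 0 1)) j i := by
  obtain ⟨S, hS, hc⟩ := exists_heightCount_eq hd n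
  have hz := iterate_opF_mem_symDist hd n
  simp_rw [hc]
  set z := (opF d)^[n] (Pi.single 0 1)
  rw [transition, if_pos h, ← Finset.mul_sum]
  by_cases h0 : ∑ l ∈ Finset.Icc (j - 1) (j + 1), z l = 0
  · have := (Finset.sum_eq_zero_iff_of_nonneg fun l _ => hz.1 l).1 h0 i h
    rw [h0, this]
    simp
  · field_simp

/-- Words of length `r + 1` are pairs of a letter and a word of length `r`. -/
def vectorSuccEquiv (α : Type*) (r : ℕ) : List.Vector α (r + 1) ≃ α × List.Vector α r where
  toFun v := (v.head, v.tail)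
  invFun p := p.1 ::ᵥ p.2
  left_inv v := List.Vector.cons_head_tail v
  right_inv p := by simp

/-- Each word of length r is the parent of exactly d words. -/
lemma prod_vector_succ_tail {d r : ℕ} {M : Type*} [CommMonoid M] (f : List (Fin d) → M) :
    ∏ v : List.Vector (Fin d) (r + 1), f v.1.tail =
      ∏ u : List.Vector (Fin d) r, f u.1 ^ d := by
  rw [Fintype.prod_equiv (vectorSuccEquiv (Fin d) r) (fun v => f v.1.tail) (fun p => f p.2.1),
    Fintype.prod_prod_type, Finset.prod_comm]
  · simp
  · rintro ⟨v, hv⟩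
    cases v with
    | nil => simp at hv
    | cons a u => rfl

/-- The functions in `zeroBoundary d n` that agree with `ξ` up to distance `r` from the root. -/
def cylinder (d n r : ℕ) (ξ : List (Fin d) → ℤ) : Set (ball d n → ℤ) :=
  {f | f ∈ zeroBoundary d n ∧ ∀ v : ball d n, v.1.length ≤ r → f v = ξ v.1}

/-- `ξ` changes by at most one along the edges of the ball of radius `r`. -/
def LipschitzUpTo {d : ℕ} (r : ℕ) (ξ : List (Fin d) → ℤ) : Prop :=
  ∀ (a : Fin d) (u : List (Fin d)), u.length < r → ξ (a :: u) ∈ Finset.Icc (ξ u - 1) (ξ u + 1)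

lemma mem_ball_iff {d n : ℕ} {v : List (Fin d)} : v ∈ ball d n ↔ v.length ≤ n := Iff.rfl

lemma mem_ball_of_cons {d n : ℕ} {a : Fin d} {u : List (Fin d)} (h : a :: u ∈ ball d n) :
    u ∈ ball d n := by
  simp only [mem_ball_iff, List.length_cons] at h ⊢
  omega

lemma mem_zeroBoundary_iff {d n : ℕ} {f : ball d n → ℤ} :
    f ∈ zeroBoundary d n ↔
      (∀ (a : Fin d) (u : List (Fin d)) (h : a :: u ∈ ball d n),
        f ⟨a :: u, h⟩ ∈ Finset.Icc (f ⟨u, mem_ball_of_cons h⟩ - 1)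
          (f ⟨u, mem_ball_of_cons h⟩ + 1)) ∧
      ∀ v : ball d n, v.1.length = n → f v = 0 := by
  refine and_congr_left fun _ => ⟨fun h a u hu => ?_, fun h => ?_⟩
  · have hadj : ((daryTree d).induce (ball d n)).Adj ⟨u, mem_ball_of_cons hu⟩ ⟨a :: u, hu⟩ := by
      simp only [SimpleGraph.comap_adj, daryTree, SimpleGraph.fromRel_adj]
      exact ⟨(List.cons_ne_self a u).symm, Or.inl ⟨a, rfl⟩⟩
    have := abs_le.1 (h _ _ hadj)
    rw [Finset.mem_Icc]
    push_cast at this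
    constructor <;> linarith [this.1, this.2]
  · rintro ⟨u, hu⟩ ⟨v, hv⟩ hadj
    simp only [SimpleGraph.comap_adj, daryTree, SimpleGraph.fromRel_adj] at hadj
    rcases hadj.2 with ⟨a, ha⟩ | ⟨a, ha⟩
    · change v = a :: u at ha
      subst ha
      have := Finset.mem_Icc.1 (h a u hv)
      rw [abs_le]
      push_cast
      constructor <;> linarith [this.1, this.2]
    · change u = a :: v at ha
      subst ha
      have := Finset.mem_Icc.1 (h a v hu)
      rw [abs_le]
      push_cast
      constructor <;> linarith [this.1, this.2]

instance finite_ball (d n : ℕ) : Finite (ball d n) := (List.finite_length_le (Fin d) n).to_subtype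

lemma cylinder_eq_empty {d n r : ℕ} (hr : r ≤ n) {ξ : List (Fin d) → ℤ}
    (h : ¬ LipschitzUpTo r ξ) : cylinder d n r ξ = ∅ := by
  rw [Set.eq_empty_iff_forall_notMem]
  rintro f ⟨hf, hfξ⟩
  refine h fun a u hu => ?_
  have hmem : a :: u ∈ ball d n := by
    simp only [mem_ball_iff, List.length_cons]; omega
  have := (mem_zeroBoundary_iff.1 hf).1 a u hmem
  rwa [hfξ ⟨a :: u, hmem⟩ (by simpa using hu), hfξ ⟨u, _⟩ hu.le] at this

/-- Replace the values of `ξ` at distance `r` from the root by `p`. -/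
def replaceLevel {d : ℕ} (r : ℕ) (ξ : List (Fin d) → ℤ) (p : List.Vector (Fin d) r → ℤ) :
    List (Fin d) → ℤ :=
  fun v => if h : v.length = r then p ⟨v, h⟩ else ξ v

lemma replaceLevel_of_length_lt {d r : ℕ} (ξ : List (Fin d) → ℤ) (p : List.Vector (Fin d) r → ℤ)
    {v : List (Fin d)} (h : v.length < r) : replaceLevel r ξ p v = ξ v :=
  dif_neg h.ne

lemma replaceLevel_apply {d r : ℕ} (ξ : List (Fin d) → ℤ) (p : List.Vector (Fin d) r → ℤ)
    (v : List.Vector (Fin d) r) : replaceLevel r ξ p v.1 = p v :=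
  dif_pos v.2

/-- The admissible values at distance `r` from the root, given `ξ` up to distance `r - 1`. -/
def levelExtensions {d : ℕ} (r : ℕ) (ξ : List (Fin d) → ℤ) :
    Finset (List.Vector (Fin d) r → ℤ) :=
  Fintype.piFinset fun v => Finset.Icc (ξ v.1.tail - 1) (ξ v.1.tail + 1)

lemma lipschitzUpTo_replaceLevel {d r : ℕ} {ξ : List (Fin d) → ℤ} (h : LipschitzUpTo r ξ)
    {p : List.Vector (Fin d) (r + 1) → ℤ} (hp : p ∈ levelExtensions (r + 1) ξ) :
    LipschitzUpTo (r + 1) (replaceLevel (r + 1) ξ p) := by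
  intro a u hu
  rw [replaceLevel_of_length_lt ξ p hu]
  by_cases hl : u.length = r
  · have hl' : (a :: u).length = r + 1 := by simp [hl]
    rw [show replaceLevel (r + 1) ξ p (a :: u) = p ⟨a :: u, hl'⟩ from
      replaceLevel_apply ξ p ⟨a :: u, hl'⟩]
    exact Fintype.mem_piFinset.1 hp ⟨a :: u, hl'⟩
  · rw [replaceLevel_of_length_lt ξ p (by simp only [List.length_cons]; omega)]
    exact h a u (by omega)

lemma cylinder_eq_biUnion {d n r : ℕ} (hr : r < n) (ξ : List (Fin d) → ℤ) :
    cylinder d n r ξ =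
      ⋃ p ∈ levelExtensions (r + 1) ξ, cylinder d n (r + 1) (replaceLevel (r + 1) ξ p) := by
  ext f
  simp only [Set.mem_iUnion, exists_prop]
  constructor
  · rintro ⟨hf, hfξ⟩
    have hmem : ∀ v : List.Vector (Fin d) (r + 1), v.1 ∈ ball d n := fun v => by
      simp only [mem_ball_iff, v.2]; omega
    refine ⟨fun v => f ⟨v.1, hmem v⟩, Fintype.mem_piFinset.2 ?_, hf, fun v hv => ?_⟩
    · rintro ⟨v, hv⟩
      cases v with
      | nil => simp at hv
      | cons a u =>
        have := (mem_zeroBoundary_iff.1 hf).1 a u (hmem ⟨a :: u, hv⟩)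
        rwa [hfξ ⟨u, _⟩ (by simp at hv; exact hv.le)] at this
    · rcases Nat.lt_or_eq_of_le hv with h | h
      · rw [replaceLevel_of_length_lt _ _ h]
        exact hfξ v (by omega)
      · exact (replaceLevel_apply ξ (fun v => f ⟨v.1, hmem v⟩) ⟨v.1, h⟩).symm
  · rintro ⟨p, hp, hf, hfξ⟩
    refine ⟨hf, fun v hv => ?_⟩
    rw [hfξ v (by omega), replaceLevel_of_length_lt _ _ (by omega)]

/-- Once level r is fixed, the subtrees hanging from it are filled in independently. The induction
uncovers one more level, and the sum over its admissible values of a product becomes a product of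
sums. -/
lemma count_cylinder {d n r m : ℕ} (hn : n = r + m) {ξ : List (Fin d) → ℤ}
    (hξ : LipschitzUpTo r ξ) :
    Measure.count (cylinder d n r ξ) =
      ((∏ v : List.Vector (Fin d) r, heightCount d m (ξ v.1) : ℕ) : ENNReal) := by
  induction m generalizing r ξ with
  | zero =>
    by_cases h : ∀ v : List.Vector (Fin d) r, ξ v.1 = 0
    · have hs : cylinder d n r ξ = {fun v => ξ v.1} := by
        ext f
        simp only [Set.mem_singleton_iff]
        constructor
        · rintro ⟨_, hf⟩
          funext v
          exact hf v (by have := v.2; simp only [mem_ball_iff] at this; omega)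
        · rintro rfl
          refine ⟨mem_zeroBoundary_iff.2 ⟨fun a u hu => hξ a u ?_, fun v hv => ?_⟩,
            fun v _ => rfl⟩
          · simp only [mem_ball_iff, List.length_cons] at hu
            omega
          · exact h ⟨v.1, by omega⟩
      rw [hs, Measure.count_singleton, Finset.prod_eq_one, Nat.cast_one]
      intro v _
      simp [heightCount, h v]
    · push Not at h
      obtain ⟨v, hv⟩ := h
      have hs : cylinder d n r ξ = ∅ := by
        rw [Set.eq_empty_iff_forall_notMem]
        rintro f ⟨hf, hfξ⟩
        have hmem : v.1 ∈ ball d n := by simp only [mem_ball_iff, v.2]; omega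
        have h1 := hfξ ⟨v.1, hmem⟩ v.2.le
        rw [hf.2 ⟨v.1, hmem⟩ (by rw [v.2]; omega)] at h1
        exact hv h1.symm
      rw [hs, measure_empty, Finset.prod_eq_zero (Finset.mem_univ v), Nat.cast_zero]
      simp [heightCount, hv]
  | succ m ih =>
    rw [cylinder_eq_biUnion (by omega), measure_biUnion_finset]
    · rw [Finset.sum_congr rfl fun p hp =>
        ih (by omega) (lipschitzUpTo_replaceLevel hξ hp), ← Nat.cast_sum]
      congr 1
      simp_rw [replaceLevel_apply]
      rw [levelExtensions, ← Finset.prod_univ_sum,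
        prod_vector_succ_tail
          (fun u => ∑ j ∈ Finset.Icc (ξ u - 1) (ξ u + 1), heightCount d m j)]
      rfl
    · intro p _ q _ hpq
      rw [Function.onFun, Set.disjoint_left]
      rintro f ⟨_, hf⟩ ⟨_, hg⟩
      refine hpq (funext fun v => ?_)
      have hmem : v.1 ∈ ball d n := by simp only [mem_ball_iff, v.2]; omega
      rw [← replaceLevel_apply ξ p, ← replaceLevel_apply ξ q, ← hf ⟨v.1, hmem⟩ v.2.le,
        hg ⟨v.1, hmem⟩ v.2.le]
    · exact fun _ _ => MeasurableSet.of_discrete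

/-- The Markov property in counting form, valid for every `ξ`: a jump larger than 1 makes a
transition factor, or both cylinder counts, vanish. -/
lemma count_cylinder_succ {d n r m : ℕ} (hd : 1 ≤ d) (hn : n = r + 1 + m)
    (ξ : List (Fin d) → ℤ) :
    Measure.count (cylinder d n (r + 1) ξ) = Measure.count (cylinder d n r ξ) *
      ENNReal.ofReal (∏ v : List.Vector (Fin d) (r + 1),
        transition ((opF d)^[m] (Pi.single 0 1)) (ξ v.1.tail) (ξ v.1)) := by
  by_cases hr : LipschitzUpTo r ξ
  · by_cases hr1 : LipschitzUpTo (r + 1) ξ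
    · have hz := iterate_opF_mem_symDist hd m
      rw [count_cylinder hn hr1, count_cylinder (m := m + 1) (by omega) hr,
        ← ENNReal.ofReal_natCast, ← ENNReal.ofReal_natCast,
        ← ENNReal.ofReal_mul (Nat.cast_nonneg _)]
      congr 1
      simp only [heightCount]
      rw [← prod_vector_succ_tail
        (fun u => ∑ j ∈ Finset.Icc (ξ u - 1) (ξ u + 1), heightCount d m j)]
      push_cast
      rw [← Finset.prod_mul_distrib]
      refine Finset.prod_congr rfl fun v _ => heightCount_eq_transition hd m ?_
      obtain ⟨v, hv⟩ := v
      cases v with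
      | nil => simp at hv
      | cons a u => exact hr1 a u (by simp at hv; omega)
    · rw [cylinder_eq_empty (by omega) hr1, measure_empty]
      have : ∃ v : List.Vector (Fin d) (r + 1),
          ξ v.1 ∉ Finset.Icc (ξ v.1.tail - 1) (ξ v.1.tail + 1) := by
        by_contra! hcon
        refine hr1 fun a u hu => ?_
        rcases Nat.lt_or_eq_of_le (Nat.le_of_lt_succ hu) with h | h
        · exact hr a u h
        · exact hcon ⟨a :: u, by simp [h]⟩
      obtain ⟨v, hv⟩ := this
      rw [Finset.prod_eq_zero (Finset.mem_univ v) (if_neg hv), ENNReal.ofReal_zero, mul_zero]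
  · rw [cylinder_eq_empty (by omega) hr, cylinder_eq_empty (by omega), measure_empty, zero_mul]
    exact fun h => hr fun a u hu => h a u (by omega)

lemma count_cylinder_zero (d n : ℕ) (ξ : List (Fin d) → ℤ) :
    Measure.count (cylinder d n 0 ξ) = (heightCount d n (ξ []) : ENNReal) := by
  rw [count_cylinder (m := n) (by omega) (fun a u hu => absurd hu (by omega))]
  congr 1
  rw [Fintype.prod_eq_single (List.Vector.nil) fun v hv => absurd (List.Vector.eq_nil v) hv]
  rfl

lemma count_zeroBoundary (d n : ℕ) :
    Measure.count (zeroBoundary d n) = ∑' i, (heightCount d n i : ENNReal) := by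
  have hnil : ([] : List (Fin d)) ∈ ball d n := by simp [ball]
  have hs : zeroBoundary d n = ⋃ i : ℤ, cylinder d n 0 (fun _ => i) := by
    ext f
    simp only [Set.mem_iUnion]
    constructor
    · intro hf
      refine ⟨f ⟨[], hnil⟩, hf, ?_⟩
      rintro ⟨v, hv'⟩ hv
      have : v = [] := List.length_eq_zero_iff.1 (by simpa using hv)
      subst this
      rfl
    · rintro ⟨i, hf, _⟩
      exact hf
  rw [hs, measure_iUnion]
  · exact tsum_congr fun i => count_cylinder_zero d n _
  · intro i j hij
    rw [Function.onFun, Set.disjoint_left]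
    rintro f ⟨_, hf⟩ ⟨_, hg⟩
    exact hij ((hf ⟨[], hnil⟩ le_rfl).symm.trans (hg ⟨[], hnil⟩ le_rfl))
  · exact fun _ => MeasurableSet.of_discrete

/-- The event that a function on the tree of height `n` agrees with `ξ` up to distance `r`. -/
def agreeUpTo {d : ℕ} (n r : ℕ) (ξ : List (Fin d) → ℤ) : Set (ball d n → ℤ) :=
  {f | ∀ v : ball d n, v.1.length ≤ r → f v = ξ v.1}

lemma mu0_agreeUpTo (d n r : ℕ) (ξ : List (Fin d) → ℤ) :
    mu0 d n (agreeUpTo n r ξ) =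
      (Measure.count (zeroBoundary d n))⁻¹ * Measure.count (cylinder d n r ξ) := by
  rw [mu0, ProbabilityTheory.uniformOn, ProbabilityTheory.cond_apply MeasurableSet.of_discrete]
  rfl

lemma mu0_agreeUpTo_zero {d : ℕ} (hd : 1 ≤ d) (n : ℕ) (ξ : List (Fin d) → ℤ) :
    mu0 d n (agreeUpTo n 0 ξ) = ENNReal.ofReal ((opF d)^[n] (Pi.single 0 1) (ξ [])) := by
  obtain ⟨S, hS, hc⟩ := exists_heightCount_eq hd n
  have hz := iterate_opF_mem_symDist hd n
  set z := (opF d)^[n] (Pi.single 0 1)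
  have hc' : ∀ i, (heightCount d n i : ENNReal) = ENNReal.ofReal (S * z i) := fun i => by
    rw [← hc, ENNReal.ofReal_natCast]
  rw [mu0_agreeUpTo, count_cylinder_zero, count_zeroBoundary]
  simp_rw [hc']
  rw [← ENNReal.ofReal_tsum_of_nonneg (fun i => mul_nonneg hS.le (hz.1 i))
    (hz.2.1.summable.mul_left S), tsum_mul_left, hz.2.1.tsum_eq, mul_one,
    ← ENNReal.ofReal_inv_of_pos hS, ← ENNReal.ofReal_mul (by positivity)]
  congr 1
  field_simp

lemma mu0_agreeUpTo_succ {d n r m : ℕ} (hd : 1 ≤ d) (hn : n = r + 1 + m)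
    (ξ : List (Fin d) → ℤ) :
    mu0 d n (agreeUpTo n (r + 1) ξ) = mu0 d n (agreeUpTo n r ξ) *
      ENNReal.ofReal (∏ v : List.Vector (Fin d) (r + 1),
        transition ((opF d)^[m] (Pi.single 0 1)) (ξ v.1.tail) (ξ v.1)) := by
  rw [mu0_agreeUpTo, mu0_agreeUpTo, count_cylinder_succ hd hn, mul_assoc]

/-! ### The tree-indexed Markov chain -/

/-- The probability mass function on `ℤ` with the given real weights. -/
def pmfOfReal (f : ℤ → ℝ) (h0 : ∀ i, 0 ≤ f i) (h1 : HasSum f 1) : PMF ℤ :=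
  ⟨fun i => ENNReal.ofReal (f i), by
    rw [← ENNReal.ofReal_one, ← h1.tsum_eq, ENNReal.ofReal_tsum_of_nonneg h0 h1.summable]
    exact ENNReal.summable.hasSum⟩

lemma pmfOfReal_toMeasure_singleton (f : ℤ → ℝ) (h0 : ∀ i, 0 ≤ f i) (h1 : HasSum f 1) (i : ℤ) :
    (pmfOfReal f h0 h1).toMeasure {i} = ENNReal.ofReal (f i) :=
  PMF.toMeasure_apply_singleton _ i (MeasurableSet.singleton i)

lemma hasSum_transition {p : ℤ → ℝ} (hp : ∀ i, 0 < p i) (j : ℤ) :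
    HasSum (transition p j) 1 := by
  have hS : 0 < ∑ l ∈ Finset.Icc (j - 1) (j + 1), p l :=
    Finset.sum_pos (fun l _ => hp l) ⟨j, by simp⟩
  have h : HasSum (transition p j) (∑ i ∈ Finset.Icc (j - 1) (j + 1), transition p j i) :=
    hasSum_sum_of_ne_finset_zero fun i hi => if_neg hi
  have e : ∑ i ∈ Finset.Icc (j - 1) (j + 1), transition p j i = 1 := by
    rw [← div_self hS.ne', Finset.sum_div]
    exact Finset.sum_congr rfl fun i hi => if_pos hi
  rwa [e] at h

/-- A function on the `d`-ary tree sampled from independent inputs `ω (v, j)`: the value at `v`,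
given that the value at the parent of `v` is `j`. -/
def sample {d : ℕ} (ω : List (Fin d) × ℤ → ℤ) : List (Fin d) → ℤ
  | [] => ω ([], 0)
  | a :: u => ω (a :: u, sample ω u)

lemma measurable_sample {d : ℕ} : Measurable (sample (d := d)) := by
  refine measurable_pi_lambda _ fun v => ?_
  induction v with
  | nil => exact measurable_pi_apply _
  | cons a u ih =>
    have h : Measurable fun q : (List (Fin d) × ℤ → ℤ) × ℤ => q.1 (a :: u, q.2) :=
      measurable_from_prod_countable_left fun j =>
        measurable_pi_apply ((a :: u, j) : List (Fin d) × ℤ)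
    exact h.comp (measurable_id.prodMk ih)

/-- The value of `ξ` at the parent of a vertex (`0` for the root). -/
def parentValue {d : ℕ} (ξ : List (Fin d) → ℤ) : List (Fin d) → ℤ
  | [] => 0
  | _ :: u => ξ u

/-- The words of length at most `r`. -/
def wordsUpTo (d r : ℕ) : Finset (List (Fin d)) := (List.finite_length_le (Fin d) r).toFinset

lemma mem_wordsUpTo {d r : ℕ} {v : List (Fin d)} : v ∈ wordsUpTo d r ↔ v.length ≤ r := by
  simp [wordsUpTo]

/-- Agreement with `ξ` consults a single input per vertex, the one indexed by the parent value
prescribed by `ξ`. These inputs are distinct, so the probability factorizes. -/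
lemma sample_eq_iff {d : ℕ} (r : ℕ) (ξ : List (Fin d) → ℤ) (ω : List (Fin d) × ℤ → ℤ) :
    (∀ v : List (Fin d), v.length ≤ r → sample ω v = ξ v) ↔
      ∀ v : List (Fin d), v.length ≤ r → ω (v, parentValue ξ v) = ξ v := by
  constructor
  · intro h v hv
    rw [← h v hv]
    cases v with
    | nil => rfl
    | cons a u =>
      rw [sample, h u (by simp at hv; omega)]
      rfl
  · intro h v
    induction v with
    | nil => exact h []
    | cons a u ih =>
      intro hv
      rw [sample, ih (by simp at hv; omega)]
      exact h _ hv

lemma prod_wordsUpTo_succ {d r : ℕ} {M : Type*} [CommMonoid M] (f : List (Fin d) → M) :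
    ∏ v ∈ wordsUpTo d (r + 1), f v =
      (∏ v ∈ wordsUpTo d r, f v) * ∏ v : List.Vector (Fin d) (r + 1), f v.1 := by
  let e : List.Vector (Fin d) (r + 1) ↪ List (Fin d) := ⟨fun v => v.1, fun v w h => Subtype.ext h⟩
  have h : wordsUpTo d (r + 1) = (wordsUpTo d r).disjUnion
      (Finset.univ.map e)
      (by
        rw [Finset.disjoint_left]
        intro v hv hv'
        obtain ⟨w, -, rfl⟩ := Finset.mem_map.1 hv'
        have := mem_wordsUpTo.1 hv
        have h2 : (e w).length = r + 1 := w.2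
        omega) := by
    ext v
    rw [Finset.mem_disjUnion, mem_wordsUpTo, mem_wordsUpTo, Finset.mem_map]
    constructor
    · intro hv
      rcases Nat.lt_or_eq_of_le hv with h | h
      · exact Or.inl (by omega)
      · exact Or.inr ⟨⟨v, h⟩, Finset.mem_univ _, rfl⟩
    · rintro (h | ⟨w, -, rfl⟩)
      · omega
      · exact w.2.le
  rw [h, Finset.prod_disjUnion, Finset.prod_map]
  rfl

section treeMeasure

variable {d : ℕ} {p : ℤ → ℝ} (hp : ∀ i, 0 < p i) (hs : HasSum p 1)

/-- The laws of the independent inputs of `sample`. -/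
def inputLaw (d : ℕ) : List (Fin d) × ℤ → PMF ℤ
  | ([], _) => pmfOfReal p (fun i => (hp i).le) hs
  | (_ :: _, j) => pmfOfReal (transition p j) (transition_nonneg (fun i => (hp i).le) j)
      (hasSum_transition hp j)

/-- The law of the Markov chain indexed by the `d`-ary tree with root law `p` and transition
probabilities `transition p`. -/
def treeMeasure (d : ℕ) : Measure (List (Fin d) → ℤ) :=
  (Measure.infinitePi fun q => (inputLaw hp hs d q).toMeasure).map sample

instance isProbabilityMeasure_treeMeasure : IsProbabilityMeasure (treeMeasure hp hs d) :=
  Measure.isProbabilityMeasure_map measurable_sample.aemeasurable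

lemma treeMeasure_apply (r : ℕ) (ξ : List (Fin d) → ℤ) :
    treeMeasure hp hs d {f | ∀ v : List (Fin d), v.length ≤ r → f v = ξ v} =
      ∏ v ∈ wordsUpTo d r, (inputLaw hp hs d (v, parentValue ξ v)).toMeasure {ξ v} := by
  have hmeas : MeasurableSet {f : List (Fin d) → ℤ | ∀ v, v.length ≤ r → f v = ξ v} := by
    have : {f : List (Fin d) → ℤ | ∀ v, v.length ≤ r → f v = ξ v} =
        Set.pi (wordsUpTo d r : Set (List (Fin d))) fun v => {ξ v} := by
      ext f
      simp [Set.mem_pi, mem_wordsUpTo]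
    rw [this]
    exact MeasurableSet.pi (Finset.countable_toSet _) fun v _ => MeasurableSet.singleton _
  rw [treeMeasure, Measure.map_apply measurable_sample hmeas]
  let e : List (Fin d) ↪ List (Fin d) × ℤ :=
    ⟨fun v => (v, parentValue ξ v), fun v w h => (Prod.ext_iff.1 h).1⟩
  have hset : sample ⁻¹' {f : List (Fin d) → ℤ | ∀ v, v.length ≤ r → f v = ξ v} =
      Set.pi ((wordsUpTo d r).map e : Finset (List (Fin d) × ℤ)) fun q => {ξ q.1} := by
    ext ω
    simp only [Set.mem_preimage, Set.mem_ofPred_eq, sample_eq_iff, Set.mem_pi, Finset.mem_coe,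
      Finset.mem_map, mem_wordsUpTo, Set.mem_singleton_iff]
    constructor
    · rintro h _ ⟨v, hv, rfl⟩
      exact h v hv
    · intro h v hv
      exact h _ ⟨v, hv, rfl⟩
  rw [hset, Measure.infinitePi_pi _ fun _ _ => MeasurableSet.singleton _, Finset.prod_map]
  rfl

lemma treeMeasure_zero (ξ : List (Fin d) → ℤ) :
    treeMeasure hp hs d {f | ∀ v : List (Fin d), v.length ≤ 0 → f v = ξ v} =
      ENNReal.ofReal (p (ξ [])) := by
  rw [treeMeasure_apply]
  have : wordsUpTo d 0 = {[]} := by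
    ext v
    simp [mem_wordsUpTo]
  rw [this, Finset.prod_singleton]
  exact pmfOfReal_toMeasure_singleton p (fun i => (hp i).le) hs _

lemma treeMeasure_succ (r : ℕ) (ξ : List (Fin d) → ℤ) :
    treeMeasure hp hs d {f | ∀ v : List (Fin d), v.length ≤ r + 1 → f v = ξ v} =
      treeMeasure hp hs d {f | ∀ v : List (Fin d), v.length ≤ r → f v = ξ v} *
        ENNReal.ofReal (∏ v : List.Vector (Fin d) (r + 1),
          transition p (ξ v.1.tail) (ξ v.1)) := by
  rw [treeMeasure_apply, treeMeasure_apply, prod_wordsUpTo_succ,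
    ENNReal.ofReal_prod_of_nonneg fun v _ => transition_nonneg (fun i => (hp i).le) _ _]
  congr 1
  refine Finset.prod_congr rfl fun v _ => ?_
  obtain ⟨v, hv⟩ := v
  cases v with
  | nil => simp at hv
  | cons a u =>
    exact pmfOfReal_toMeasure_singleton (transition p (ξ u))
      (transition_nonneg (fun i => (hp i).le) _) (hasSum_transition hp _) _

lemma tendsto_mu0_agreeUpTo (hd : 1 ≤ d)
    (h : ∀ i, Tendsto (fun n => (opF d)^[n] (Pi.single 0 1) i) atTop (𝓝 (p i)))
    (r : ℕ) (ξ : List (Fin d) → ℤ) :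
    Tendsto (fun n => mu0 d n (agreeUpTo n r ξ)) atTop
      (𝓝 (treeMeasure hp hs d {f | ∀ v : List (Fin d), v.length ≤ r → f v = ξ v})) := by
  have ht : ∀ j i, Tendsto (fun n => transition ((opF d)^[n] (Pi.single 0 1)) j i) atTop
      (𝓝 (transition p j i)) := by
    intro j i
    unfold transition
    split_ifs
    · exact (h i).div (tendsto_finsetSum _ fun l _ => h l)
        (Finset.sum_pos (fun l _ => hp l) ⟨j, by simp⟩).ne'
    · exact tendsto_const_nhds
  induction r with
  | zero =>
    rw [treeMeasure_zero]
    simp_rw [mu0_agreeUpTo_zero hd]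
    exact ENNReal.tendsto_ofReal (h _)
  | succ r ih =>
    rw [treeMeasure_succ]
    have hprod : Tendsto (fun n => ENNReal.ofReal (∏ v : List.Vector (Fin d) (r + 1),
        transition ((opF d)^[n] (Pi.single 0 1)) (ξ v.1.tail) (ξ v.1))) atTop
        (𝓝 (ENNReal.ofReal (∏ v : List.Vector (Fin d) (r + 1),
          transition p (ξ v.1.tail) (ξ v.1)))) :=
      ENNReal.tendsto_ofReal (tendsto_finsetProd _ fun v _ => ht _ _)
    -- Below level r + 1 the subtrees have height n - (r + 1), which tends to infinity with n.
    refine (ENNReal.Tendsto.mul ih (Or.inr ENNReal.ofReal_ne_top)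
      (hprod.comp (tendsto_sub_atTop_nat (r + 1))) (Or.inr (measure_ne_top _ _))).congr' ?_
    filter_upwards [eventually_ge_atTop (r + 1)] with n hn
    exact (mu0_agreeUpTo_succ hd (show n = r + 1 + (n - (r + 1)) by omega) ξ).symm

end treeMeasure

/-- Extension by zero of a function on the ball of radius `r`. -/
def extendByZero {d r : ℕ} (ξ : ball d r → ℤ) : List (Fin d) → ℤ :=
  Function.extend Subtype.val ξ 0

lemma extendByZero_apply {d r : ℕ} (ξ : ball d r → ℤ) (v : ball d r) :
    extendByZero ξ v.1 = ξ v :=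
  Subtype.val_injective.extend_apply ξ 0 v

lemma restrictEq_eq_agreeUpTo {d r : ℕ} (n : ℕ) (ξ : ball d r → ℤ) :
    restrictEq n ξ = agreeUpTo n r (extendByZero ξ) := by
  ext f
  constructor
  · intro h v hv
    rw [h v.1 v.2 hv]
    exact (extendByZero_apply ξ ⟨v.1, hv⟩).symm
  · intro h v hn hr
    rw [h ⟨v, hn⟩ hr]
    exact extendByZero_apply ξ ⟨v, hr⟩

lemma localWeakConverges_of_tendsto {d : ℕ} (hd : 1 ≤ d) {p : ℤ → ℝ} (hp : ∀ i, 0 < p i)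
    (hs : HasSum p 1)
    (h : ∀ i, Tendsto (fun n => (opF d)^[n] (Pi.single 0 1) i) atTop (𝓝 (p i))) :
    LocalWeakConverges (mu0 d) := by
  refine ⟨treeMeasure hp hs d, inferInstance, fun r ξ => ?_⟩
  simp_rw [restrictEq_eq_agreeUpTo]
  have hset : {f : List (Fin d) → ℤ | ∀ v : ball d r, f v = ξ v} =
      {f | ∀ v : List (Fin d), v.length ≤ r → f v = extendByZero ξ v} := by
    ext f
    constructor
    · intro hf v hv
      rw [hf ⟨v, hv⟩]
      exact (extendByZero_apply ξ ⟨v, hv⟩).symm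
    · intro hf v
      rw [hf v.1 v.2, extendByZero_apply]
  rw [hset]
  exact tendsto_mu0_agreeUpTo hp hs hd h r (extendByZero ξ)

/-- Local weak convergence forces convergence of the root marginals to a probability law. -/
lemma exists_root_limit {d : ℕ} (hd : 1 ≤ d) (h : LocalWeakConverges (mu0 d)) :
    ∃ p : ℤ → ℝ, (∀ i, 0 ≤ p i) ∧ HasSum p 1 ∧
      ∀ i, Tendsto (fun n => (opF d)^[n] (Pi.single 0 1) i) atTop (𝓝 (p i)) := by
  obtain ⟨ν, hν, hlim⟩ := h
  have hroot : Measurable fun f : List (Fin d) → ℤ => f [] := measurable_pi_apply _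
  have hsum : HasSum (fun i : ℤ => ν {f | f [] = i}) 1 := by
    have h1 : ∑' i : ℤ, ν {f | f [] = i} = 1 := by
      rw [← measure_univ (μ := ν), ← measure_iUnion]
      · congr 1
        ext f
        simp
      · intro i j hij
        rw [Function.onFun, Set.disjoint_left]
        intro f hf hg
        exact hij ((show f [] = i from hf).symm.trans hg)
      · exact fun i => hroot (MeasurableSet.singleton i)
    rw [← h1]
    exact ENNReal.summable.hasSum
  refine ⟨fun i => (ν {f | f [] = i}).toReal, fun i => ENNReal.toReal_nonneg, ?_, fun i => ?_⟩
  · have := ENNReal.hasSum_toReal (f := fun i : ℤ => ν {f | f [] = i})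
      (by rw [hsum.tsum_eq]; exact ENNReal.one_ne_top)
    rwa [← ENNReal.tsum_toReal_eq (fun i => measure_ne_top _ _), hsum.tsum_eq,
      ENNReal.toReal_one] at this
  · have h0 := hlim 0 fun _ => i
    have hset : {f : List (Fin d) → ℤ | ∀ v : ball d 0, f v = i} = {f | f [] = i} := by
      ext f
      constructor
      · intro hf
        exact hf ⟨[], by simp [ball]⟩
      · rintro hf ⟨v, hv⟩
        have : v = [] := List.length_eq_zero_iff.1 (Nat.le_zero.1 hv)
        subst this
        exact hf
    rw [hset] at h0
    refine ((ENNReal.tendsto_toReal (measure_ne_top _ _)).comp h0).congr fun n => ?_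
    rw [Function.comp_apply, restrictEq_eq_agreeUpTo, mu0_agreeUpTo_zero hd,
      ENNReal.toReal_ofReal ((iterate_opF_mem_symDist hd n).1 _)]
    rw [show extendByZero (fun _ : ball d 0 => i) [] = i from
      extendByZero_apply (fun _ => i) ⟨[], Nat.le_refl 0⟩]

/-! ### Failure of convergence for `d = 1` and for `8 ≤ d` -/

lemma tsum_opA_one {z : ℤ → ℝ} (hz : HasSum z 1) : ∑' i, opA 1 z i = 3 := by
  have h := (((Equiv.subRight (1 : ℤ)).hasSum_iff.2 hz).add hz).add
    ((Equiv.addRight (1 : ℤ)).hasSum_iff.2 hz)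
  have e : (fun i => opA 1 z i) = fun i => (z ∘ Equiv.subRight (1 : ℤ)) i + z i +
      (z ∘ Equiv.addRight (1 : ℤ)) i := by
    funext i
    simp [opA]
  rw [e, h.tsum_eq]
  norm_num

/-- A function on `ℤ` that equals the mean of its values over `{i - 1, i, i + 1}` for all `i`
is affine. -/
lemma eq_add_mul_of_mean {p : ℤ → ℝ} (h : ∀ i, p i = (p (i - 1) + p i + p (i + 1)) / 3) (n : ℕ) :
    p n = p 0 + n * (p 1 - p 0) := by
  have key : ∀ n : ℕ, p n = p 0 + n * (p 1 - p 0) ∧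
      p ((n + 1 : ℕ) : ℤ) = p 0 + (n + 1 : ℕ) * (p 1 - p 0) := by
    intro n
    induction n with
    | zero => simp
    | succ n ih =>
      refine ⟨ih.2, ?_⟩
      have h1 := h ((n + 1 : ℕ) : ℤ)
      rw [show (((n + 1 : ℕ) : ℤ) - 1) = n by push_cast; ring] at h1
      rw [show (((n + 1 + 1 : ℕ) : ℤ)) = ((n + 1 : ℕ) : ℤ) + 1 by push_cast; ring]
      rw [ih.1, ih.2] at h1
      push_cast at h1 ⊢
      linarith
  exact (key n).1

/-- A limit law would be fixed by averaging over three neighbours, so affine on the naturals, with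
slope 0 by symmetry at the origin. Being summable, it would vanish. -/
lemma not_localWeakConverges_one : ¬ LocalWeakConverges (mu0 1) := by
  intro h
  obtain ⟨p, hp0, hp1, hlim⟩ := exists_root_limit le_rfl h
  have hmean : ∀ i, p i = (p (i - 1) + p i + p (i + 1)) / 3 := by
    intro i
    refine tendsto_nhds_unique ((tendsto_add_atTop_iff_nat 1).2 (hlim i)) ?_
    refine ((((hlim (i - 1)).add (hlim i)).add (hlim (i + 1))).div_const 3).congr fun n => ?_
    rw [Function.iterate_succ_apply', opF,
      tsum_opA_one (iterate_opF_mem_symDist le_rfl n).2.1, opA, pow_one]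
  have hzero : Tendsto (fun n : ℕ => p n) atTop (𝓝 0) :=
    (hp1.summable.comp_injective Nat.cast_injective).tendsto_atTop_zero
  have hsymm : p 1 = p (-1) := tendsto_nhds_unique (hlim 1)
    ((hlim (-1)).congr fun n => (iterate_opF_mem_symDist le_rfl n).2.2.1 1)
  have h01 : p 1 = p 0 := by
    have := hmean 0
    norm_num at this
    rw [← hsymm] at this
    linarith
  have hconst : ∀ n : ℕ, p n = p 0 := fun n => by
    rw [eq_add_mul_of_mean hmean n, h01]
    ring
  have hp00 : p 0 = 0 := by
    simp_rw [hconst] at hzero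
    exact tendsto_nhds_unique tendsto_const_nhds hzero
  have hall : ∀ i, p i = 0 := by
    intro i
    have hs : ∀ j, p (-j) = p j := fun j => tendsto_nhds_unique (hlim (-j))
      ((hlim j).congr fun n => ((iterate_opF_mem_symDist le_rfl n).2.2.1 j).symm)
    obtain ⟨n, rfl | rfl⟩ := Int.eq_nat_or_neg i
    · rw [hconst, hp00]
    · rw [hs, hconst, hp00]
  have : p = fun _ => 0 := funext hall
  rw [this] at hp1
  exact one_ne_zero (hp1.unique hasSum_zero)

/-- All ratios are at most 1, so a limit law has its maximum at 0 and `p 0` is nonzero. The first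
ratio would then converge to `p 1 / p 0`, against the oscillation between the two boxes. -/
lemma not_localWeakConverges_of_eight_le {d : ℕ} (hd : 8 ≤ d) :
    ¬ LocalWeakConverges (mu0 d) := by
  intro h
  have hd1 : 1 ≤ d := by omega
  obtain ⟨p, hp0, hp1, hlim⟩ := exists_root_limit hd1 h
  have hbox : ∀ n, (ratioStep d)^[n] 0 ∈ ratioBox 0 1 (1 / 2) := fun n =>
    iterate_ratioStep_mem_half (by omega) n (zero_mem_ratioBox zero_le_one (by norm_num))
  have hle : ∀ i, p i ≤ p 0 := fun i => by
    refine le_of_tendsto_of_tendsto' (hlim i) (hlim 0) fun n => ?_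
    have hz := iterate_opF_mem_symDist hd1 n
    rw [symDist_eq_prod hz i, ratio_iterate_opF hd1]
    refine mul_le_of_le_one_right (hz.1 0)
      (Finset.prod_le_one (fun j _ => (hbox n).1 j) fun j _ => ?_)
    cases j with
    | zero => exact (hbox n).2.2.1
    | succ j => linarith [(hbox n).2.2.2 j]
  have hpos : p 0 ≠ 0 := by
    intro h0
    have : p = fun _ => 0 := funext fun i => le_antisymm ((hle i).trans h0.le) (hp0 i)
    rw [this] at hp1
    exact one_ne_zero (hp1.unique hasSum_zero)
  refine not_tendsto_iterate_ratioStep_zero hd (p 1 / p 0) ?_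
  refine ((hlim 1).div (hlim 0) hpos).congr fun n => ?_
  rw [← ratio_iterate_opF hd1]
  simp [ratio]

lemma localWeakConverges_iff {d : ℕ} (hd : 1 ≤ d) :
    LocalWeakConverges (mu0 d) ↔ 2 ≤ d ∧ d ≤ 7 := by
  constructor
  · intro h
    by_contra hcon
    by_cases h1 : d = 1
    · subst h1
      exact not_localWeakConverges_one h
    · exact not_localWeakConverges_of_eight_le (by omega) h
  · rintro ⟨h2, h7⟩
    obtain ⟨p, hp, hs, h⟩ := exists_tendsto_iterate_opF h2 h7
    exact localWeakConverges_of_tendsto hd hp hs h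

end TreeLipschitz

end

theorem theorem1 (d : ℕ) (hd : 1 ≤ d) :
    (TreeLipschitz.LocalWeakConverges (TreeLipschitz.mu0 d) ↔ 2 ≤ d ∧ d ≤ 7) ∧
    (8 ≤ d →
      (∀ x ∈ TreeLipschitz.upperBasin, ∀ y ∈ TreeLipschitz.lowerBasin d, 0.26 ≤ x 0 - y 0) ∧
      Set.MapsTo (TreeLipschitz.psi d) TreeLipschitz.upperBasin (TreeLipschitz.lowerBasin d) ∧
      Set.MapsTo (TreeLipschitz.psi d) (TreeLipschitz.lowerBasin d) TreeLipschitz.upperBasin ∧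
      (∀ k : ℕ, (TreeLipschitz.psi d)^[2 * k] 0 ∈ TreeLipschitz.lowerBasin d ∧
        (TreeLipschitz.psi d)^[2 * k + 1] 0 ∈ TreeLipschitz.upperBasin) ∧
      ¬ ∃ x : ℕ → ℝ, Tendsto (fun n => (TreeLipschitz.psi d)^[n] 0) atTop (𝓝 x)) := by
  open TreeLipschitz in
  exact ⟨localWeakConverges_iff hd, fun h8 => ⟨fun _ hx _ hy => basin_gap h8 hx hy,
    mapsTo_psi_upperBasin h8, mapsTo_psi_lowerBasin h8, iterate_psi_mem h8,
    not_tendsto_iterate_psi h8⟩⟩
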